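/- **Conventions.** A scoring game is an integer, or a pair $\{G^L\mid G^R\}$ of finite nonempty families of scoring games (the Left and Right options). An integer is even-tempered; $\{G^L\mid G^R\}$ is even- (odd-) tempered if all of its options are odd- (even-) tempered; a game is well-tempered if it is even-tempered ($\pi(G)=0$) or odd-tempered ($\pi(G)=1$), with $\pi(G)\in\mathbb{Z}/2$. The outcomes $\operatorname{L}(G),\operatorname{R}(G)$ are the final scores under optimal play when Left (the maximizer), respectively Right (the minimizer), moves first. For $f:\mathbb{Z}\times\mathbb{Z}\to\mathbb{Z}$ the extension of $f$ to games plays two games in parallel and combines the final scores by $f$; $G+H$, $G\vee H$, $G\wedge H$ are the extensions of $x+y$, $\max(x,y)$, $\min(x,y)$. Write $G\lesssim H$ if $\operatorname{L}(G+X)\le\operatorname{L}(H+X)$ and $\operatorname{R}(G+X)\le\operatorname{R}(H+X)$ for all well-tempered $X$, and $G\approx H$ if equality always holds. Let $\mathcal{W}_{\{0,1\}}$ be the class of well-tempered games whose integer subgames all lie in $\{0,1\}$ (Boolean-valued games), $\mathbf{W}_{\{0,1\}}=\mathcal{W}_{\{0,1\}}/\!\approx$, and $\mathcal{I}_{\{0,1\}}$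 the class of those $G\in\mathcal{W}_{\{0,1\}}$ for which the supremum of $\operatorname{R}(H)-\operatorname{L}(H)$ over the even-tempered subgames $H$ of $G$ is $0$. Partizan games are short normal-play games, $=$ is equality of values, and $x\lhd y$ means that $y\le x$ fails. Put $\int_1^{1/2}G=\{\int_1^{1/2}G^L+\tfrac12\mid\int_1^{1/2}G^R-\tfrac12\}$. Let $\{G^L\mid G^R\}_+$ (respectively $\{G^L\mid G^R\}_-$) be the largest (respectively smallest) integer $n$ with $G^L\lhd n\lhd G^R$ for all $G^L,G^R$ if there is such an integer, and $\{G^L\mid G^R\}$ otherwise. Define maps $\psi,\psi^+,\psi^-$ from scoring games to values of partizan games by $\psi(n)=\psi^\pm(n)=n$ for integers $n$, and $\psi(\{G^L\mid G^R\})=\{\psi(G^L)\mid\psi(G^R)\}$, $\psi^\pm(\{G^L\mid G^R\})=\{\psi^\pm(G^L)\mid\psi^\pm(G^R)\}_\pm$ otherwise. Finally let $$S=\{0,\tfrac14,\tfrac38,\tfrac12,\tfrac12{*},\tfrac58,\tfrac34,1\},$$ a set of eight partizan games, where $\tfrac12{*}=\tfrac12+*$. **Theorem.** 1. $\{\psi(G):G\in\mathcal{W}_{\{0,1\}},\pi(G)=0\}=\{\int_1^{1/2}x:x\in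 S\}$ and $\{\psi(G):G\in\mathcal{W}_{\{0,1\}},\pi(G)=1\}=\{*+\int_1^{1/2}x:x\in S\}$. The same two equalities hold with $\mathcal{I}_{\{0,1\}}$ in place of $\mathcal{W}_{\{0,1\}}$, and with $\psi^+$ or $\psi^-$ in place of $\psi$. The two sets on the right are disjoint. 2. For every $G\in\mathcal{W}_{\{0,1\}}$ there are unique $u^+(G),u^-(G)\in S$ such that $\psi^\pm(G)=\int_1^{1/2}u^\pm(G)$ if $G$ is even-tempered, and $\psi^\pm(G)=*+\int_1^{1/2}u^\pm(G)$ if $G$ is odd-tempered. 3. The map $G\mapsto(u^+(G),u^-(G),\pi(G))$ induces a bijection from $\mathbf{W}_{\{0,1\}}$ onto $\{(x,y,i):x,y\in S,\ x\ge y,\ i\in\mathbb{Z}/2\}$. It is an isomorphism of posets: for $G,H\in\mathcal{W}_{\{0,1\}}$, $G\lesssim H$ if and only if $u^+(G)\le u^+(H)$, $u^-(G)\le u^-(H)$ and $\pi(G)=\pi(H)$. There are exactly $70$ Boolean-valued games up to $\approx$. 4. For all $x,y\in S$ there are a greatest element $x\cup y$ of $S$ that is $\le x+y$ and a least element $x\cap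 y$ of $S$ that is $\ge x+y-1$. For all $G,H\in\mathcal{W}_{\{0,1\}}$, $u^\pm(G\vee H)=u^\pm(G)\cup u^\pm(H)$ and $u^\pm(G\wedge H)=u^\pm(G)\cap u^\pm(H)$. 5. Let $G\in\mathcal{W}_{\{0,1\}}$. If $G$ is even-tempered, then $\operatorname{L}(G)=0\iff u^-(G)=0$, and $\operatorname{R}(G)=1\iff u^+(G)=1$. If $G$ is odd-tempered, then $\operatorname{L}(G)=0\iff u^+(G)\le\tfrac12$, and $\operatorname{R}(G)=1\iff u^-(G)\ge\tfrac12$. -/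

import Mathlib

/-! ### Short partizan games under normal play -/

/-- A short partizan game (a form): finitely many Left options and finitely many Right options. -/
inductive PGame : Type
  | mk (l r : ℕ) (L : Fin l → PGame) (R : Fin r → PGame) : PGame

namespace PGame

/-- Auxiliary to `cmp`: the recursion on the second game. -/
def cmpAux {l r : ℕ} (cL : Fin l → PGame → Prop × Prop) (cR : Fin r → PGame → Prop × Prop) :
    PGame → Prop × Prop
  | mk l' r' L' R' =>
    ((∀ i, ¬ (cL i (mk l' r' L' R')).2) ∧ (∀ j, ¬ (cmpAux cL cR (R' j)).2),
     (∀ i, ¬ (cmpAux cL cR (L' i)).1) ∧ (∀ j, ¬ (cR j (mk l' r' L' R')).1))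

/-- `cmp G H` is the pair of propositions `(G ≤ H, H ≤ G)`, where `G ≤ H` means that no Left
option of `G` is `≥ H` and no Right option of `H` is `≤ G` (see `mk_le_mk`). -/
def cmp : PGame → PGame → Prop × Prop
  | mk _ _ L R => cmpAux (fun i => cmp (L i)) (fun j => cmp (R j))

instance : LE PGame := ⟨fun G H => (cmp G H).1⟩

theorem cmp_swap (G H : PGame) :
    ((cmp G H).1 ↔ (cmp H G).2) ∧ ((cmp G H).2 ↔ (cmp H G).1) := by
  induction G generalizing H with
  | mk l r L R ihL ihR =>
    induction H with
    | mk l' r' L' R' ihL' ihR' =>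
      constructor
      · exact and_congr (forall_congr' fun i => not_congr (ihL i _).2)
          (forall_congr' fun j => not_congr (ihR' j).2)
      · exact and_congr (forall_congr' fun i => not_congr (ihL' i).1)
          (forall_congr' fun j => not_congr (ihR j _).1)

/-- The defining recursion of the order on partizan games. -/
theorem mk_le_mk {l r l' r' : ℕ} (L : Fin l → PGame) (R : Fin r → PGame)
    (L' : Fin l' → PGame) (R' : Fin r' → PGame) :
    mk l r L R ≤ mk l' r' L' R' ↔
      (∀ i, ¬ mk l' r' L' R' ≤ L i) ∧ (∀ j, ¬ R' j ≤ mk l r L R) :=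
  and_congr (forall_congr' fun i => not_congr (cmp_swap (L i) (mk l' r' L' R')).2)
    (forall_congr' fun j => not_congr (cmp_swap (mk l r L R) (R' j)).2)

protected theorem le_refl (G : PGame) : G ≤ G := by
  induction G with
  | mk l r L R ihL ihR =>
    rw [mk_le_mk]
    refine ⟨fun i h => ?_, fun j h => ?_⟩
    · cases hL : L i with
      | mk a b A B =>
        have h' := h
        rw [hL, mk_le_mk] at h'
        exact h'.1 i (hL ▸ ihL i)
    · cases hR : R j with
      | mk a b A B =>
        have h' := h
        rw [hR, mk_le_mk] at h'
        exact h'.2 j (hR ▸ ihR j)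

theorem le_trans_aux (x y z : PGame) :
    (x ≤ y → y ≤ z → x ≤ z) ∧ (y ≤ z → z ≤ x → y ≤ x) ∧ (z ≤ x → x ≤ y → z ≤ y) := by
  induction x generalizing y z with
  | mk xl xr xL xR ixL ixR =>
    induction y generalizing z with
    | mk yl yr yL yR iyL iyR =>
      induction z with
      | mk zl zr zL zR izL izR =>
        refine ⟨fun h1 h2 => ?_, fun h1 h2 => ?_, fun h1 h2 => ?_⟩
        · exact (mk_le_mk ..).2
            ⟨fun i h => ((mk_le_mk ..).1 h1).1 i ((ixL i _ _).2.1 h2 h),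
             fun j h => ((mk_le_mk ..).1 h2).2 j ((izR j).2.2 h h1)⟩
        · exact (mk_le_mk ..).2
            ⟨fun i h => ((mk_le_mk ..).1 h1).1 i ((iyL i _).2.2 h2 h),
             fun j h => ((mk_le_mk ..).1 h2).2 j ((ixR j _ _).1 h h1)⟩
        · exact (mk_le_mk ..).2
            ⟨fun i h => ((mk_le_mk ..).1 h1).1 i ((izL i).1 h2 h),
             fun j h => ((mk_le_mk ..).1 h2).2 j ((iyR j _).2.1 h h1)⟩

instance : Preorder PGame where
  le_refl := PGame.le_refl
  le_trans x y z h1 h2 := (le_trans_aux x y z).1 h1 h2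

/-- `G ⊲ H`: `G` is less than or fuzzy to `H`. -/
def LF (G H : PGame) : Prop := ¬ H ≤ G

/-- The negative of a game: the players' roles are exchanged. -/
protected def neg : PGame → PGame
  | mk l r L R => mk r l (fun j => (R j).neg) (fun i => (L i).neg)

instance : Neg PGame := ⟨PGame.neg⟩

/-- Auxiliary to `add`: the recursion on the second summand. -/
def addAux {l r : ℕ} (aL : Fin l → PGame → PGame) (aR : Fin r → PGame → PGame) : PGame → PGame
  | mk l' r' L' R' =>
    mk (l + l') (r + r')
      (Fin.append (fun i => aL i (mk l' r' L' R')) (fun i => addAux aL aR (L' i)))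
      (Fin.append (fun j => aR j (mk l' r' L' R')) (fun j => addAux aL aR (R' j)))

/-- The disjunctive sum `G + H = {G^L + H, G + H^L | G^R + H, G + H^R}`. -/
protected def add : PGame → PGame → PGame
  | mk _ _ L R => addAux (fun i => (L i).add) (fun j => (R j).add)

instance : Add PGame := ⟨PGame.add⟩

theorem mk_add_mk {l r l' r' : ℕ} (L : Fin l → PGame) (R : Fin r → PGame)
    (L' : Fin l' → PGame) (R' : Fin r' → PGame) :
    mk l r L R + mk l' r' L' R' =
      mk (l + l') (r + r')
        (Fin.append (fun i => L i + mk l' r' L' R') (fun i => mk l r L R + L' i))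
        (Fin.append (fun j => R j + mk l' r' L' R') (fun j => mk l r L R + R' j)) :=
  rfl

instance : Sub PGame := ⟨fun G H => G + -H⟩

/-- The game `{ | }`. -/
instance : Zero PGame := ⟨mk 0 0 ![] ![]⟩

/-- The game `{0 | }`. -/
instance : One PGame := ⟨mk 1 0 ![0] ![]⟩

/-- The game `* = {0 | 0}`. -/
def star : PGame := mk 1 1 ![0] ![0]

/-- The natural number `n` as a game, `n + 1 = {n | }`. -/
def ofNat : ℕ → PGame
  | 0 => 0
  | n + 1 => mk 1 0 ![ofNat n] ![]

/-- The integer `n` as a game. -/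
def ofInt : ℤ → PGame
  | Int.ofNat n => ofNat n
  | Int.negSucc n => -ofNat (n + 1)

/-- `1/2 = {0 | 1}`. -/
def half : PGame := mk 1 1 ![0] ![1]

/-- `1/4 = {0 | 1/2}`. -/
def quarter : PGame := mk 1 1 ![0] ![half]

/-- `3/4 = {1/2 | 1}`. -/
def threeQuarters : PGame := mk 1 1 ![half] ![1]

/-- `3/8 = {1/4 | 1/2}`. -/
def threeEighths : PGame := mk 1 1 ![quarter] ![half]

/-- `5/8 = {1/2 | 3/4}`. -/
def fiveEighths : PGame := mk 1 1 ![half] ![threeQuarters]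

/-- The overheating operation
`∫_1^{1/2} G = {∫_1^{1/2} G^L + 1/2 | ∫_1^{1/2} G^R - 1/2}`. -/
def overheat : PGame → PGame
  | mk l r L R => mk l r (fun i => overheat (L i) + half) (fun j => overheat (R j) - half)

/-- The integers `n` with `G^L ⊲ n ⊲ G^R` for all `G^L` and `G^R`. -/
def integersBetween {l r : ℕ} (L : Fin l → PGame) (R : Fin r → PGame) : Set ℤ :=
  {n | (∀ i, LF (L i) (ofInt n)) ∧ (∀ j, LF (ofInt n) (R j))}

open Classical in
/-- `{G^L | G^R}_+`: the largest integer between the `G^L` and the `G^R` if there is an integer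
between them, and `{G^L | G^R}` otherwise. It is applied to nonempty families only, and for
these the set of integers between them is bounded. -/
noncomputable def bracesPlus {l r : ℕ} (L : Fin l → PGame) (R : Fin r → PGame) : PGame :=
  if (integersBetween L R).Nonempty then ofInt (sSup (integersBetween L R)) else mk l r L R

open Classical in
/-- `{G^L | G^R}_-`: the same with the smallest integer. -/
noncomputable def bracesMinus {l r : ℕ} (L : Fin l → PGame) (R : Fin r → PGame) : PGame :=
  if (integersBetween L R).Nonempty then ofInt (sInf (integersBetween L R)) else mk l r L R

/-- The set `S = {0, 1/4, 3/8, 1/2, 1/2 + *, 5/8, 3/4, 1}`. -/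
def boolS : Set PGame :=
  {0, quarter, threeEighths, half, half + star, fiveEighths, threeQuarters, 1}

end PGame

/-- The poset `Pg` of values: short partizan games up to the equivalence `G ≤ H ∧ H ≤ G`. -/
abbrev Pg : Type := Antisymmetrization PGame (· ≤ ·)

/-- The value of a partizan game. -/
def PGame.val (G : PGame) : Pg := toAntisymmetrization (· ≤ ·) G

/-! ### Scoring games -/

/-- A scoring game: an integer (the final score), or a position with finitely many, but at least
one, Left options and finitely many, but at least one, Right options. -/
inductive ScoringGame : Type
  | int (n : ℤ) : ScoringGame
  | node (l r : ℕ) (L : Fin (l + 1) → ScoringGame) (R : Fin (r + 1) → ScoringGame) : ScoringGame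

namespace ScoringGame

/-- `G.Tempered 0`: `G` is even-tempered; `G.Tempered 1`: `G` is odd-tempered. -/
def Tempered : ScoringGame → ZMod 2 → Prop
  | int _, i => i = 0
  | node _ _ L R, i => (∀ k, (L k).Tempered (i + 1)) ∧ (∀ k, (R k).Tempered (i + 1))

/-- A well-tempered game is an even-tempered game or an odd-tempered game. -/
def WellTempered (G : ScoringGame) : Prop := G.Tempered 0 ∨ G.Tempered 1

open Classical in
/-- The parity `π(G)` of a well-tempered game. -/
noncomputable def parity (G : ScoringGame) : ZMod 2 := if G.Tempered 0 then 0 else 1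

/-- The pair of the left outcome and the right outcome. -/
def outcome : ScoringGame → ℤ × ℤ
  | int n => (n, n)
  | node _ _ L R =>
    (Finset.univ.sup' Finset.univ_nonempty (fun k => (L k).outcome.2),
     Finset.univ.inf' Finset.univ_nonempty (fun k => (R k).outcome.1))

/-- The left outcome `L(G)`: the final score when Left moves first. -/
def leftOutcome (G : ScoringGame) : ℤ := G.outcome.1

/-- The right outcome `R(G)`: the final score when Right moves first. -/
def rightOutcome (G : ScoringGame) : ℤ := G.outcome.2

/-- `H.Subgame G`: `H` is `G` or a subgame of an option of `G`. -/
inductive Subgame : ScoringGame → ScoringGame → Prop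
  | refl (G : ScoringGame) : Subgame G G
  | left {H : ScoringGame} {l r : ℕ} {L : Fin (l + 1) → ScoringGame}
      {R : Fin (r + 1) → ScoringGame} (k : Fin (l + 1)) (h : Subgame H (L k)) :
      Subgame H (node l r L R)
  | right {H : ScoringGame} {l r : ℕ} {L : Fin (l + 1) → ScoringGame}
      {R : Fin (r + 1) → ScoringGame} (k : Fin (r + 1)) (h : Subgame H (R k)) :
      Subgame H (node l r L R)

/-- `G` is `T`-valued: every integer subgame of `G` is an element of `T`. -/
def ValuedIn (T : Set ℤ) (G : ScoringGame) : Prop := ∀ n : ℤ, (int n).Subgame G → n ∈ T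

/-- The class of games whose even gap, the supremum of `R(H) - L(H)` over the even-tempered
subgames `H`, is `0`. -/
def EvenGapZero (G : ScoringGame) : Prop :=
  IsLUB {d : ℤ | ∃ H : ScoringGame, H.Subgame G ∧ H.parity = 0 ∧
    d = H.rightOutcome - H.leftOutcome} 0

/-- The extension of a function `ℤ → ℤ` to games. -/
def ext1 (f : ℤ → ℤ) : ScoringGame → ScoringGame
  | int n => int (f n)
  | node l r L R => node l r (fun k => ext1 f (L k)) (fun k => ext1 f (R k))

/-- Auxiliary to `ext2`: the recursion on the second game when the first is not an integer. -/
def ext2Aux {l r : ℕ} (eL : Fin (l + 1) → ScoringGame → ScoringGame)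
    (eR : Fin (r + 1) → ScoringGame → ScoringGame) : ScoringGame → ScoringGame
  | int n => node l r (fun k => eL k (int n)) (fun k => eR k (int n))
  | node l' r' L' R' =>
    node (l + 1 + l') (r + 1 + r')
      (Fin.append (n := l' + 1) (fun k => eL k (node l' r' L' R'))
        (fun k => ext2Aux eL eR (L' k)))
      (Fin.append (n := r' + 1) (fun k => eR k (node l' r' L' R'))
        (fun k => ext2Aux eL eR (R' k)))

/-- The extension to games of a function `f` of two integers: both games are played in parallel
and the final scores are combined by `f`. -/
def ext2 (f : ℤ → ℤ → ℤ) : ScoringGame → ScoringGame → ScoringGame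
  | int m => ext1 (f m)
  | node _ _ L R => ext2Aux (fun k => ext2 f (L k)) (fun k => ext2 f (R k))

theorem ext2_int_int (f : ℤ → ℤ → ℤ) (m n : ℤ) : ext2 f (int m) (int n) = int (f m n) := rfl

theorem ext2_int_node (f : ℤ → ℤ → ℤ) (m : ℤ) {l r : ℕ} (L : Fin (l + 1) → ScoringGame)
    (R : Fin (r + 1) → ScoringGame) :
    ext2 f (int m) (node l r L R) =
      node l r (fun k => ext2 f (int m) (L k)) (fun k => ext2 f (int m) (R k)) := rfl

theorem ext2_node_int (f : ℤ → ℤ → ℤ) (n : ℤ) {l r : ℕ} (L : Fin (l + 1) → ScoringGame)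
    (R : Fin (r + 1) → ScoringGame) :
    ext2 f (node l r L R) (int n) =
      node l r (fun k => ext2 f (L k) (int n)) (fun k => ext2 f (R k) (int n)) := rfl

theorem ext2_node_node (f : ℤ → ℤ → ℤ) {l r l' r' : ℕ} (L : Fin (l + 1) → ScoringGame)
    (R : Fin (r + 1) → ScoringGame) (L' : Fin (l' + 1) → ScoringGame)
    (R' : Fin (r' + 1) → ScoringGame) :
    ext2 f (node l r L R) (node l' r' L' R') =
      node (l + 1 + l') (r + 1 + r')
        (Fin.append (n := l' + 1) (fun k => ext2 f (L k) (node l' r' L' R'))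
          (fun k => ext2 f (node l r L R) (L' k)))
        (Fin.append (n := r' + 1) (fun k => ext2 f (R k) (node l' r' L' R'))
          (fun k => ext2 f (node l r L R) (R' k))) := rfl

/-- The disjunctive sum of scoring games. -/
instance : Add ScoringGame := ⟨ext2 (fun x y => x + y)⟩

/-- `G ≲ H`: in every well-tempered context, `H` is at least as good for Left as `G`. -/
def Lesssim (G H : ScoringGame) : Prop :=
  ∀ X : ScoringGame, X.WellTempered →
    (G + X).leftOutcome ≤ (H + X).leftOutcome ∧ (G + X).rightOutcome ≤ (H + X).rightOutcome

/-- `G ≈ H`: `G` and `H` have the same outcomes in every well-tempered context. -/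
def Equivalent (G H : ScoringGame) : Prop :=
  ∀ X : ScoringGame, X.WellTempered →
    (G + X).leftOutcome = (H + X).leftOutcome ∧ (G + X).rightOutcome = (H + X).rightOutcome

/-- The map `ψ` to partizan games. -/
def psi : ScoringGame → PGame
  | int n => PGame.ofInt n
  | node l r L R => PGame.mk (l + 1) (r + 1) (fun k => (L k).psi) (fun k => (R k).psi)

/-- The map `ψ⁺` to partizan games. -/
noncomputable def psiPlus : ScoringGame → PGame
  | int n => PGame.ofInt n
  | node _ _ L R => PGame.bracesPlus (fun k => (L k).psiPlus) (fun k => (R k).psiPlus)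

/-- The map `ψ⁻` to partizan games. -/
noncomputable def psiMinus : ScoringGame → PGame
  | int n => PGame.ofInt n
  | node _ _ L R => PGame.bracesMinus (fun k => (L k).psiMinus) (fun k => (R k).psiMinus)

theorem Tempered.ext1 (f : ℤ → ℤ) {G : ScoringGame} {i : ZMod 2} (h : G.Tempered i) :
    (ext1 f G).Tempered i := by
  induction G generalizing i with
  | int n => exact h
  | node l r L R ihL ihR => exact ⟨fun k => ihL k (h.1 k), fun k => ihR k (h.2 k)⟩

theorem forall_append {m n : ℕ} {p : ScoringGame → Prop} {u : Fin m → ScoringGame}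
    {v : Fin n → ScoringGame} (hu : ∀ k, p (u k)) (hv : ∀ k, p (v k)) (k : Fin (m + n)) :
    p (Fin.append u v k) := by
  refine Fin.addCases (fun i => ?_) (fun i => ?_) k
  · rw [Fin.append_left]; exact hu i
  · rw [Fin.append_right]; exact hv i

theorem Tempered.ext2 (f : ℤ → ℤ → ℤ) {G H : ScoringGame} {i j : ZMod 2}
    (hG : G.Tempered i) (hH : H.Tempered j) : (ext2 f G H).Tempered (i + j) := by
  induction G generalizing H i j with
  | int m =>
    cases (show i = 0 from hG)
    rw [zero_add]
    exact hH.ext1 (f m)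
  | node l r L R ihL ihR =>
    induction H generalizing j with
    | int n =>
      have e1 : i + j + 1 = i + 1 + j := by ring
      rw [ext2_node_int]
      exact ⟨fun k => e1 ▸ ihL k (hG.1 k) hH, fun k => e1 ▸ ihR k (hG.2 k) hH⟩
    | node l' r' L' R' ihL' ihR' =>
      have e1 : i + j + 1 = i + 1 + j := by ring
      have e2 : i + j + 1 = i + (j + 1) := by ring
      rw [ext2_node_node]
      exact ⟨forall_append (p := fun K => K.Tempered (i + j + 1)) (fun k => e1 ▸ ihL k (hG.1 k) hH)
          (fun k => e2 ▸ ihL' k (hH.1 k)),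
        forall_append (p := fun K => K.Tempered (i + j + 1)) (fun k => e1 ▸ ihR k (hG.2 k) hH)
          (fun k => e2 ▸ ihR' k (hH.2 k))⟩

theorem WellTempered.ext2 (f : ℤ → ℤ → ℤ) {G H : ScoringGame} (hG : G.WellTempered)
    (hH : H.WellTempered) : (ext2 f G H).WellTempered := by
  rcases hG with hG | hG <;> rcases hH with hH | hH
  · exact Or.inl (hG.ext2 f hH)
  · exact Or.inr (hG.ext2 f hH)
  · exact Or.inr (hG.ext2 f hH)
  · exact Or.inl (hG.ext2 f hH)

theorem valuedIn_int {T : Set ℤ} {n : ℤ} : (int n).ValuedIn T ↔ n ∈ T := by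
  refine ⟨fun h => h n (Subgame.refl _), fun h m hm => ?_⟩
  cases hm
  exact h

theorem valuedIn_node {T : Set ℤ} {l r : ℕ} {L : Fin (l + 1) → ScoringGame}
    {R : Fin (r + 1) → ScoringGame} :
    (node l r L R).ValuedIn T ↔ (∀ k, (L k).ValuedIn T) ∧ (∀ k, (R k).ValuedIn T) := by
  refine ⟨fun h => ⟨fun k n hn => h n (Subgame.left k hn), fun k n hn => h n (Subgame.right k hn)⟩,
    fun h n hn => ?_⟩
  cases hn with
  | left k hk => exact h.1 k n hk
  | right k hk => exact h.2 k n hk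

theorem ValuedIn.ext2 {T : Set ℤ} {f : ℤ → ℤ → ℤ} (hf : ∀ x ∈ T, ∀ y ∈ T, f x y ∈ T)
    {G H : ScoringGame} (hG : G.ValuedIn T) (hH : H.ValuedIn T) : (ext2 f G H).ValuedIn T := by
  induction G generalizing H with
  | int m =>
    induction H with
    | int n => exact valuedIn_int.2 (hf m (valuedIn_int.1 hG) n (valuedIn_int.1 hH))
    | node l' r' L' R' ihL' ihR' =>
      rw [valuedIn_node] at hH
      rw [ext2_int_node]
      exact valuedIn_node.2 ⟨fun k => ihL' k (hH.1 k), fun k => ihR' k (hH.2 k)⟩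
  | node l r L R ihL ihR =>
    have hG' := valuedIn_node.1 hG
    induction H with
    | int n =>
      rw [ext2_node_int]
      exact valuedIn_node.2 ⟨fun k => ihL k (hG'.1 k) hH, fun k => ihR k (hG'.2 k) hH⟩
    | node l' r' L' R' ihL' ihR' =>
      have hH' := valuedIn_node.1 hH
      rw [ext2_node_node]
      exact valuedIn_node.2
        ⟨forall_append (fun k => ihL k (hG'.1 k) hH) (fun k => ihL' k (hH'.1 k)),
         forall_append (fun k => ihR k (hG'.2 k) hH) (fun k => ihR' k (hH'.2 k))⟩

end ScoringGame

/-! ### Boolean-valued games -/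

/-- The Boolean-valued, that is `{0, 1}`-valued, well-tempered games. -/
abbrev BoolGame : Type := {G : ScoringGame // G.WellTempered ∧ G.ValuedIn {0, 1}}

namespace BoolGame

/-- `G ∨ H`, the extension to games of logical or, `i ∨ j = max i j`. -/
def or (G H : BoolGame) : BoolGame :=
  ⟨ScoringGame.ext2 max G.1 H.1, G.2.1.ext2 max H.2.1,
    G.2.2.ext2 (by rintro x (rfl | rfl) y (rfl | rfl) <;> simp) H.2.2⟩

/-- `G ∧ H`, the extension to games of logical and, `i ∧ j = min i j`. -/
def and (G H : BoolGame) : BoolGame :=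
  ⟨ScoringGame.ext2 min G.1 H.1, G.2.1.ext2 min H.2.1,
    G.2.2.ext2 (by rintro x (rfl | rfl) y (rfl | rfl) <;> simp) H.2.2⟩

/-- Equivalence of scoring games, restricted to Boolean-valued games. -/
instance equivalence : Setoid BoolGame where
  r G H := ScoringGame.Equivalent G.1 H.1
  iseqv :=
    ⟨fun _ _ _ => ⟨rfl, rfl⟩, fun h X hX => ⟨(h X hX).1.symm, (h X hX).2.symm⟩,
     fun h h' X hX => ⟨(h X hX).1.trans (h' X hX).1, (h X hX).2.trans (h' X hX).2⟩⟩

end BoolGame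

/-- Boolean-valued games modulo equivalence. -/
abbrev BoolGameClass : Type := Quotient BoolGame.equivalence

/-- The partizan game `∫_1^{1/2} x` for even parity, and `* + ∫_1^{1/2} x` for odd parity. -/
def PGame.parityOverheat (i : ZMod 2) (x : PGame) : PGame :=
  if i = 0 then x.overheat else PGame.star + x.overheat

/-! In a well-tempered game the parity and the first player determine who makes the last move, so
comparison splits into two independent problems: `s = 0`, where Left moves last, and `s = 1`, where
Right does. For each `s` the relation `Comp s` is a comparison in Conway's style, a strategy for
Left to do at least as well in `H` as in `G`, with an extra clause at integers. It controls one
outcome of each parity (`Comp.outcome`), is transitive on games of matching parity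
(`Comp.trans_aux`), and survives the extension of any function that is monotone in each variable
(`Comp.ext2_mono`).

For fixed `s`, every Boolean-valued game of a given parity is equivalent to one of eight canonical
games. A Left option matters only through the opposite-parity values that it fails to exceed, and
this leaves four levels (`tier`); Right options likewise have four levels (`bar`). So the value of a
position is a function `step` of its best tier and its best bar (`hasValue_of_options`). The
parameter `s` enters in one case only: an even-tempered position with tier 0 and bar 3, a mutual
zugzwang with both 0 and 1 between its options. The player who will move last can wait, so the value
is 1 for `s = 0` and 0 for `s = 1`.

Partizan values of the canonical games have the same tier-bar comparison table. Hence `ψ⁺` and `ψ⁻`,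
which resolve the ambiguous case by the largest or the smallest integer, obey the recursions of
`step 0` and `step 1`, while plain `ψ` takes the simplest number 0 and also follows `step 1`
(`represents_mk`, `represents_braces`). Thus `u⁺` and `u⁻` are the values for `s = 0` and `s = 1`.

Different values are told apart by adding a canonical game of dual value (`outcome_canon_add_canon`,
`HasValue.le_of_lesssim`), different parities by adding `{-2 | 2}`. All pairs `y ≤ x` are realized
by explicit constructions (`attained`). Since `Comp` respects `max` and `min`, the rules for `∨` and
`∧` need checking on canonical games only. What remains are finite checks on the eight values. -/

theorem ZMod.add_one_ne : ∀ i : ZMod 2, i + 1 ≠ i := by decide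

theorem ZMod.add_one_eq_of_ne : ∀ {i j : ZMod 2}, i ≠ j → i + 1 = j := by decide

theorem ZMod.eq_one_of_zero_ne : ∀ {i : ZMod 2}, 0 ≠ i → i = 1 := by decide

theorem ZMod.eq_zero_or_eq_one : ∀ i : ZMod 2, i = 0 ∨ i = 1 := by decide

theorem ZMod.add_one_add_one : ∀ i : ZMod 2, i + 1 + 1 = i := by decide

/-! ### Options and outcomes of scoring games -/

namespace ScoringGame

/-- `K.IsLeft G`: `K` is a Left option of `G`. -/
def IsLeft (K : ScoringGame) : ScoringGame → Prop
  | int _ => False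
  | node _ _ L _ => ∃ k, K = L k

/-- `K.IsRight G`: `K` is a Right option of `G`. -/
def IsRight (K : ScoringGame) : ScoringGame → Prop
  | int _ => False
  | node _ _ _ R => ∃ k, K = R k

theorem option_induction {p : ScoringGame → Prop}
    (h : ∀ G, (∀ K, IsLeft K G → p K) → (∀ K, IsRight K G → p K) → p G) (G : ScoringGame) :
    p G := by
  induction G with
  | int n => exact h _ (fun K hK => hK.elim) (fun K hK => hK.elim)
  | node l r L R ihL ihR =>
    exact h _ (fun K ⟨k, hk⟩ => hk ▸ ihL k) (fun K ⟨k, hk⟩ => hk ▸ ihR k)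

theorem Tempered.isLeft {G K : ScoringGame} {i : ZMod 2} (h : G.Tempered i) (hK : IsLeft K G) :
    K.Tempered (i + 1) := by
  cases G with
  | int n => exact hK.elim
  | node l r L R => obtain ⟨k, rfl⟩ := hK; exact h.1 k

theorem Tempered.isRight {G K : ScoringGame} {i : ZMod 2} (h : G.Tempered i)
    (hK : IsRight K G) : K.Tempered (i + 1) := by
  cases G with
  | int n => exact hK.elim
  | node l r L R => obtain ⟨k, rfl⟩ := hK; exact h.2 k

theorem Tempered.unique {G : ScoringGame} {i j : ZMod 2} (hi : G.Tempered i)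
    (hj : G.Tempered j) : i = j := by
  induction G generalizing i j with
  | int n => exact (show i = 0 from hi).trans (show j = 0 from hj).symm
  | node l r L R ihL ihR => exact add_right_cancel (ihL 0 (hi.1 0) (hj.1 0))

theorem rightOutcome_le_leftOutcome_of_isLeft {G K : ScoringGame} (hK : IsLeft K G) :
    K.rightOutcome ≤ G.leftOutcome := by
  cases G with
  | int n => exact hK.elim
  | node l r L R =>
    obtain ⟨k, rfl⟩ := hK
    exact Finset.le_sup' (fun k => (L k).outcome.2) (Finset.mem_univ k)

theorem rightOutcome_le_leftOutcome_of_isRight {G K : ScoringGame} (hK : IsRight K G) :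
    G.rightOutcome ≤ K.leftOutcome := by
  cases G with
  | int n => exact hK.elim
  | node l r L R =>
    obtain ⟨k, rfl⟩ := hK
    exact Finset.inf'_le (fun k => (R k).outcome.1) (Finset.mem_univ k)

theorem exists_isLeft {G : ScoringGame} (h : ∀ n, G ≠ int n) :
    ∃ K, IsLeft K G ∧ G.leftOutcome = K.rightOutcome := by
  cases G with
  | int n => exact (h n rfl).elim
  | node l r L R =>
    obtain ⟨k, -, hk⟩ := Finset.exists_mem_eq_sup' (Finset.univ_nonempty (α := Fin (l + 1)))
      (fun k => (L k).outcome.2)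
    exact ⟨L k, ⟨k, rfl⟩, hk⟩

theorem exists_isRight {G : ScoringGame} (h : ∀ n, G ≠ int n) :
    ∃ K, IsRight K G ∧ G.rightOutcome = K.leftOutcome := by
  cases G with
  | int n => exact (h n rfl).elim
  | node l r L R =>
    obtain ⟨k, -, hk⟩ := Finset.exists_mem_eq_inf' (Finset.univ_nonempty (α := Fin (r + 1)))
      (fun k => (R k).outcome.1)
    exact ⟨R k, ⟨k, rfl⟩, hk⟩

theorem le_leftOutcome_iff {G : ScoringGame} (h : ∀ n, G ≠ int n) {c : ℤ} :
    c ≤ G.leftOutcome ↔ ∃ K, IsLeft K G ∧ c ≤ K.rightOutcome := by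
  constructor
  · intro hc
    obtain ⟨K, hK, e⟩ := exists_isLeft h
    exact ⟨K, hK, e ▸ hc⟩
  · rintro ⟨K, hK, hc⟩
    exact hc.trans (rightOutcome_le_leftOutcome_of_isLeft hK)

theorem leftOutcome_le_iff {G : ScoringGame} (h : ∀ n, G ≠ int n) {c : ℤ} :
    G.leftOutcome ≤ c ↔ ∀ K, IsLeft K G → K.rightOutcome ≤ c := by
  constructor
  · exact fun hc K hK => (rightOutcome_le_leftOutcome_of_isLeft hK).trans hc
  · intro hc
    obtain ⟨K, hK, e⟩ := exists_isLeft h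
    exact e ▸ hc K hK

theorem rightOutcome_le_iff {G : ScoringGame} (h : ∀ n, G ≠ int n) {c : ℤ} :
    G.rightOutcome ≤ c ↔ ∃ K, IsRight K G ∧ K.leftOutcome ≤ c := by
  constructor
  · intro hc
    obtain ⟨K, hK, e⟩ := exists_isRight h
    exact ⟨K, hK, e ▸ hc⟩
  · rintro ⟨K, hK, hc⟩
    exact (rightOutcome_le_leftOutcome_of_isRight hK).trans hc

theorem le_rightOutcome_iff {G : ScoringGame} (h : ∀ n, G ≠ int n) {c : ℤ} :
    c ≤ G.rightOutcome ↔ ∀ K, IsRight K G → c ≤ K.leftOutcome := by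
  constructor
  · exact fun hc K hK => hc.trans (rightOutcome_le_leftOutcome_of_isRight hK)
  · intro hc
    obtain ⟨K, hK, e⟩ := exists_isRight h
    exact e ▸ hc K hK

/-- Hides the integer cases and `Fin.append`: later arguments see a combination only through its
options. -/
theorem isLeft_ext2 {f : ℤ → ℤ → ℤ} {G H K : ScoringGame} :
    IsLeft K (ext2 f G H) ↔
      (∃ G', IsLeft G' G ∧ K = ext2 f G' H) ∨ (∃ H', IsLeft H' H ∧ K = ext2 f G H') := by
  cases G with
  | int m =>
    cases H with
    | int n => simp [ext2_int_int, IsLeft]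
    | node l' r' L' R' =>
      rw [ext2_int_node]
      simp [IsLeft]
  | node l r L R =>
    cases H with
    | int n =>
      rw [ext2_node_int]
      simp [IsLeft]
    | node l' r' L' R' =>
      rw [ext2_node_node]
      constructor
      · rintro ⟨k, rfl⟩
        revert k
        refine Fin.addCases (m := l + 1) (n := l' + 1) (fun k => Or.inl ?_) (fun k => Or.inr ?_)
        · exact ⟨_, ⟨k, rfl⟩, Fin.append_left _ _ k⟩
        · exact ⟨_, ⟨k, rfl⟩, Fin.append_right _ _ k⟩
      · rintro (⟨_, ⟨k, rfl⟩, rfl⟩ | ⟨_, ⟨k, rfl⟩, rfl⟩)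
        · exact ⟨Fin.castAdd (l' + 1) k, (Fin.append_left (n := l' + 1)
            (fun k => ext2 f (L k) (node l' r' L' R')) _ k).symm⟩
        · exact ⟨Fin.natAdd (l + 1) k, (Fin.append_right (n := l' + 1) _
            (fun k => ext2 f (node l r L R) (L' k)) k).symm⟩

theorem isRight_ext2 {f : ℤ → ℤ → ℤ} {G H K : ScoringGame} :
    IsRight K (ext2 f G H) ↔
      (∃ G', IsRight G' G ∧ K = ext2 f G' H) ∨ (∃ H', IsRight H' H ∧ K = ext2 f G H') := by
  cases G with
  | int m =>
    cases H with
    | int n => simp [ext2_int_int, IsRight]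
    | node l' r' L' R' =>
      rw [ext2_int_node]
      simp [IsRight]
  | node l r L R =>
    cases H with
    | int n =>
      rw [ext2_node_int]
      simp [IsRight]
    | node l' r' L' R' =>
      rw [ext2_node_node]
      constructor
      · rintro ⟨k, rfl⟩
        revert k
        refine Fin.addCases (m := r + 1) (n := r' + 1) (fun k => Or.inl ?_) (fun k => Or.inr ?_)
        · exact ⟨_, ⟨k, rfl⟩, Fin.append_left _ _ k⟩
        · exact ⟨_, ⟨k, rfl⟩, Fin.append_right _ _ k⟩
      · rintro (⟨_, ⟨k, rfl⟩, rfl⟩ | ⟨_, ⟨k, rfl⟩, rfl⟩)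
        · exact ⟨Fin.castAdd (r' + 1) k, (Fin.append_left (n := r' + 1)
            (fun k => ext2 f (R k) (node l' r' L' R')) _ k).symm⟩
        · exact ⟨Fin.natAdd (r + 1) k, (Fin.append_right (n := r' + 1) _
            (fun k => ext2 f (node l r L R) (R' k)) k).symm⟩

theorem ext2_eq_int_iff {f : ℤ → ℤ → ℤ} {G H : ScoringGame} {c : ℤ} :
    ext2 f G H = int c ↔ ∃ m n, G = int m ∧ H = int n ∧ f m n = c := by
  cases G with
  | int m =>
    cases H with
    | int n => simp [ext2_int_int]
    | node l' r' L' R' => simp [ext2_int_node]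
  | node l r L R =>
    cases H with
    | int n => simp [ext2_node_int]
    | node l' r' L' R' => simp [ext2_node_node]

/-- Combining with a finished game only relabels the scores, and a monotone relabelling commutes
with maxima and minima. -/
theorem outcome_ext2_int {f : ℤ → ℤ → ℤ} (n : ℤ) (hf : Monotone fun m => f m n)
    (G : ScoringGame) :
    (ext2 f G (int n)).leftOutcome = f G.leftOutcome n ∧
      (ext2 f G (int n)).rightOutcome = f G.rightOutcome n := by
  induction G with
  | int m => exact ⟨rfl, rfl⟩
  | node l r L R ihL ihR =>
    have hn : ∀ c, ext2 f (node l r L R) (int n) ≠ int c := fun c => by simp [ext2_node_int]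
    have hn' : ∀ c, node l r L R ≠ int c := fun c => by simp
    constructor
    · apply le_antisymm
      · rw [leftOutcome_le_iff hn]
        rintro K ⟨k, rfl⟩
        rw [(ihL k).2]
        exact hf (rightOutcome_le_leftOutcome_of_isLeft ⟨k, rfl⟩)
      · obtain ⟨_, ⟨k, rfl⟩, e⟩ := exists_isLeft hn'
        rw [e, ← (ihL k).2]
        exact rightOutcome_le_leftOutcome_of_isLeft ⟨k, rfl⟩
    · apply le_antisymm
      · obtain ⟨_, ⟨k, rfl⟩, e⟩ := exists_isRight hn'
        rw [e, ← (ihR k).1]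
        exact rightOutcome_le_leftOutcome_of_isRight ⟨k, rfl⟩
      · rw [le_rightOutcome_iff hn]
        rintro K ⟨k, rfl⟩
        rw [(ihR k).1]
        exact hf (rightOutcome_le_leftOutcome_of_isRight ⟨k, rfl⟩)

/-! ### Comparison of games for a fixed last player -/

/-- The condition at the integers in the comparison of two games: for `s = 0` a game below an
integer has a small right outcome, for `s = 1` a game above an integer has a large left
outcome. -/
def Bound (s : ZMod 2) (G H : ScoringGame) : Prop :=
  (s = 0 → ∀ h, H = int h → G.rightOutcome ≤ h) ∧ (s = 1 → ∀ g, G = int g → g ≤ H.leftOutcome)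

/-- `Comp s true G H` compares games of equal parity, and `Comp s false G H` compares games of
different parity when Left moves next in `H` or Right moves next in `G`. For `s = 0` this
controls the play in which Left makes the last move, for `s = 1` the play in which Right does
(see `Comp.outcome`). -/
inductive Comp (s : ZMod 2) : Bool → ScoringGame → ScoringGame → Prop
  | le {G H : ScoringGame} (hG : ∀ K, IsLeft K G → Comp s false K H)
      (hH : ∀ K, IsRight K H → Comp s false G K) (hb : Bound s G H) : Comp s true G H
  | right {G H K : ScoringGame} (hK : IsRight K G) (h : Comp s true K H) : Comp s false G H
  | left {G H K : ScoringGame} (hK : IsLeft K H) (h : Comp s true G K) : Comp s false G H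

/-- Left follows the strategy encoded in the derivation. A play can get stuck only at an integer,
which is even-tempered; `Bound` supplies exactly the inequality that is needed there. -/
theorem Comp.outcome {s : ZMod 2} {b : Bool} {G H : ScoringGame} (h : Comp s b G H) :
    ∀ i, G.Tempered i →
      (b = true → H.Tempered i → (i = s → G.rightOutcome ≤ H.rightOutcome) ∧
        (i ≠ s → G.leftOutcome ≤ H.leftOutcome)) ∧
      (b = false → H.Tempered (i + 1) → i = s → G.rightOutcome ≤ H.leftOutcome) := by
  induction h with
  | @le G H hG hH hb ihG ihH =>
    intro i hi
    refine ⟨fun _ hi' => ⟨?_, fun his => ?_⟩, fun hb => by simp at hb⟩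
    · rintro rfl
      by_cases hn : ∃ n, H = int n
      · obtain ⟨n, rfl⟩ := hn
        exact hb.1 hi' n rfl
      · rw [not_exists] at hn
        rw [le_rightOutcome_iff hn]
        exact fun K hK => (ihH K hK i hi).2 rfl (hi'.isRight hK) rfl
    · by_cases hn : ∃ n, G = int n
      · obtain ⟨n, rfl⟩ := hn
        -- An integer has parity 0, so `i ≠ s` means `s = 1` and the second clause of `Bound`
        -- applies.
        have h0 : i = 0 := hi
        subst h0
        exact hb.2 (ZMod.eq_one_of_zero_ne his) n rfl
      · rw [not_exists] at hn
        rw [leftOutcome_le_iff hn]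
        have h1 : i + 1 = s := ZMod.add_one_eq_of_ne his
        exact fun K hK => (ihG K hK (i + 1) (hi.isLeft hK)).2 rfl (i.add_one_add_one.symm ▸ hi') h1
  | @right G H K hK h ih =>
    refine fun i hi => ⟨fun hb => by simp at hb, fun _ hi' his => ?_⟩
    have := ((ih (i + 1) (hi.isRight hK)).1 rfl hi').2 (his ▸ ZMod.add_one_ne i)
    exact (rightOutcome_le_leftOutcome_of_isRight hK).trans this
  | @left G H K hK h ih =>
    refine fun i hi => ⟨fun hb => by simp at hb, fun _ hi' his => ?_⟩
    have := ((ih i hi).1 rfl (i.add_one_add_one ▸ hi'.isLeft hK)).1 his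
    exact this.trans (rightOutcome_le_leftOutcome_of_isLeft hK)

theorem Comp.rightOutcome_le {s : ZMod 2} {G H : ScoringGame} (h : Comp s true G H)
    (hG : G.Tempered s) (hH : H.Tempered s) : G.rightOutcome ≤ H.rightOutcome :=
  ((h.outcome s hG).1 rfl hH).1 rfl

theorem Comp.leftOutcome_le {s : ZMod 2} {G H : ScoringGame} (h : Comp s true G H)
    (hG : G.Tempered (s + 1)) (hH : H.Tempered (s + 1)) : G.leftOutcome ≤ H.leftOutcome :=
  ((h.outcome _ hG).1 rfl hH).2 (ZMod.add_one_ne s)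

/-- Moves in `G` or `H` are answered by the given strategy, and moves in one copy of `X` are copied
in the other. -/
theorem Comp.ext2_left {s : ZMod 2} {b : Bool} {f : ℤ → ℤ → ℤ}
    (hf : ∀ n, Monotone fun m => f m n) {G H : ScoringGame} (h : Comp s b G H)
    (X : ScoringGame) : Comp s b (ext2 f G X) (ext2 f H X) := by
  induction h generalizing X with
  | @le G H hG hH hb ihG ihH =>
    induction X using option_induction with
    | h X ihXL ihXR =>
      refine .le (fun K hK => ?_) (fun K hK => ?_) ⟨fun hs c hc => ?_, fun hs c hc => ?_⟩
      · rcases isLeft_ext2.1 hK with ⟨K', hK', rfl⟩ | ⟨X', hX', rfl⟩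
        · exact ihG K' hK' X
        · exact .left (isLeft_ext2.2 (.inr ⟨X', hX', rfl⟩)) (ihXL X' hX')
      · rcases isRight_ext2.1 hK with ⟨K', hK', rfl⟩ | ⟨X', hX', rfl⟩
        · exact ihH K' hK' X
        · exact .right (isRight_ext2.2 (.inr ⟨X', hX', rfl⟩)) (ihXR X' hX')
      · obtain ⟨m, n, rfl, rfl, rfl⟩ := ext2_eq_int_iff.1 hc
        rw [(outcome_ext2_int n (hf n) G).2]
        exact hf n (hb.1 hs m rfl)
      · obtain ⟨m, n, rfl, rfl, rfl⟩ := ext2_eq_int_iff.1 hc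
        rw [(outcome_ext2_int n (hf n) H).1]
        exact hf n (hb.2 hs m rfl)
  | right hK h ih => exact .right (isRight_ext2.2 (.inl ⟨_, hK, rfl⟩)) (ih X)
  | left hK h ih => exact .left (isLeft_ext2.2 (.inl ⟨_, hK, rfl⟩)) (ih X)

/-- Commutativity of parallel play, again by copying moves. It carries monotonicity from the first
argument to the second in `Comp.ext2_mono`. -/
theorem Comp.ext2_swap (s : ZMod 2) (f : ℤ → ℤ → ℤ) (G H : ScoringGame) :
    Comp s true (ext2 f G H) (ext2 (fun x y => f y x) H G) := by
  induction G using option_induction generalizing H with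
  | h G ihGL ihGR =>
    induction H using option_induction with
    | h H ihHL ihHR =>
      refine .le (fun K hK => ?_) (fun K hK => ?_) ⟨fun hs c hc => ?_, fun hs c hc => ?_⟩
      · rcases isLeft_ext2.1 hK with ⟨K', hK', rfl⟩ | ⟨K', hK', rfl⟩
        · exact .left (isLeft_ext2.2 (.inr ⟨K', hK', rfl⟩)) (ihGL K' hK' H)
        · exact .left (isLeft_ext2.2 (.inl ⟨K', hK', rfl⟩)) (ihHL K' hK')
      · rcases isRight_ext2.1 hK with ⟨K', hK', rfl⟩ | ⟨K', hK', rfl⟩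
        · exact .right (isRight_ext2.2 (.inr ⟨K', hK', rfl⟩)) (ihHR K' hK')
        · exact .right (isRight_ext2.2 (.inl ⟨K', hK', rfl⟩)) (ihGR K' hK' H)
      · obtain ⟨m, n, rfl, rfl, rfl⟩ := ext2_eq_int_iff.1 hc
        exact le_rfl
      · obtain ⟨m, n, rfl, rfl, rfl⟩ := ext2_eq_int_iff.1 hc
        exact le_rfl

/-- As for partizan games, transitivity of `≤` has to be proved together with the two mixed rules.
The parities enter through the integers: there the bound for the outer pair is the bound of one
comparison chained with the outcome inequality of the other. -/
theorem Comp.trans_aux {s : ZMod 2} (G H K : ScoringGame) : ∀ i, G.Tempered i →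
    (H.Tempered i → K.Tempered i → Comp s true G H → Comp s true H K → Comp s true G K) ∧
    (H.Tempered i → K.Tempered (i + 1) → Comp s true G H → Comp s false H K →
      Comp s false G K) ∧
    (H.Tempered (i + 1) → K.Tempered (i + 1) → Comp s false G H → Comp s true H K →
      Comp s false G K) := by
  induction G using option_induction generalizing H K with
  | h G ihGL ihGR =>
  induction H using option_induction generalizing K with
  | h H ihHL ihHR =>
  induction K using option_induction with
  | h K ihKL ihKR =>
  intro i hG
  refine ⟨fun hH hK h1 h2 => ?_, fun hH hK h1 h2 => ?_, fun hH hK h1 h2 => ?_⟩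
  · have h1' := h1
    have h2' := h2
    cases h1 with
    | le h1L h1R hb1 =>
    cases h2 with
    | le h2L h2R hb2 =>
    refine .le (fun X hX => ?_) (fun X hX => ?_) ⟨fun hs c hc => ?_, fun hs c hc => ?_⟩
    · exact (ihGL X hX H K (i + 1) (hG.isLeft hX)).2.2 (i.add_one_add_one.symm ▸ hH)
        (i.add_one_add_one.symm ▸ hK) (h1L X hX) h2'
    · exact (ihKR X hX i hG).2.1 hH (hK.isRight hX) h1' (h2R X hX)
    · subst hc hs
      -- All three games are even-tempered, so the right outcomes are the ones controlled by `s =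
      -- 0`.
      obtain rfl : i = 0 := hK
      exact (h1'.rightOutcome_le hG hH).trans (hb2.1 rfl c rfl)
    · subst hc hs
      obtain rfl : i = 0 := hG
      exact (hb1.2 rfl c rfl).trans (h2'.leftOutcome_le hH hK)
  · cases h2 with
    | right hX h =>
      cases h1 with
      | le h1L h1R hb1 =>
      exact (ihHR _ hX K i hG).2.2 (hH.isRight hX) hK (h1R _ hX) h
    | left hX h => exact .left hX ((ihKL _ hX i hG).1 hH (i.add_one_add_one ▸ hK.isLeft hX) h1 h)
  · cases h1 with
    | right hX h => exact .right hX ((ihGR _ hX H K (i + 1) (hG.isRight hX)).1 hH hK h h2)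
    | left hX h =>
      cases h2 with
      | le h2L h2R hb2 =>
      exact (ihHL _ hX K i hG).2.1 (i.add_one_add_one ▸ hH.isLeft hX) hK h (h2L _ hX)

theorem Comp.trans {s i : ZMod 2} {G H K : ScoringGame} (hG : G.Tempered i) (hH : H.Tempered i)
    (hK : K.Tempered i) (h1 : Comp s true G H) (h2 : Comp s true H K) : Comp s true G K :=
  (trans_aux G H K i hG).1 hH hK h1 h2

theorem Comp.trans_lf {s i : ZMod 2} {G H K : ScoringGame} (hG : G.Tempered i)
    (hH : H.Tempered i) (hK : K.Tempered (i + 1)) (h1 : Comp s true G H)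
    (h2 : Comp s false H K) : Comp s false G K :=
  (trans_aux G H K i hG).2.1 hH hK h1 h2

theorem Comp.lf_trans {s i : ZMod 2} {G H K : ScoringGame} (hG : G.Tempered i)
    (hH : H.Tempered (i + 1)) (hK : K.Tempered (i + 1)) (h1 : Comp s false G H)
    (h2 : Comp s true H K) : Comp s false G K :=
  (trans_aux G H K i hG).2.2 hH hK h1 h2

theorem Comp.ext2_mono {s i j : ZMod 2} {f : ℤ → ℤ → ℤ} (hf : ∀ n, Monotone fun m => f m n)
    (hf' : ∀ m, Monotone fun n => f m n) {G G' H H' : ScoringGame} (hG : G.Tempered i)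
    (hG' : G'.Tempered i) (hH : H.Tempered j) (hH' : H'.Tempered j) (h1 : Comp s true G G')
    (h2 : Comp s true H H') : Comp s true (ext2 f G H) (ext2 f G' H') := by
  refine .trans (hG.ext2 f hH) (hG'.ext2 f hH) (hG'.ext2 f hH') (h1.ext2_left hf H) ?_
  have e := add_comm i j
  refine .trans (hG'.ext2 f hH) (e ▸ hH.ext2 _ hG') (hG'.ext2 f hH') (.ext2_swap s f G' H) ?_
  exact .trans (e ▸ hH.ext2 _ hG') (e ▸ hH'.ext2 _ hG') (hG'.ext2 f hH')
    (h2.ext2_left hf' G') (.ext2_swap s _ H' G')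

end ScoringGame

/-! ### The eight values and their finite tables -/

/-- The eight values of Boolean-valued games of one parity: names for the elements of `boolS`. -/
inductive BoolValue : Type
  | zero | quarter | threeEighths | half | halfStar | fiveEighths | threeQuarters | one
  deriving DecidableEq

namespace BoolValue

instance : Fintype BoolValue :=
  ⟨{zero, quarter, threeEighths, half, halfStar, fiveEighths, threeQuarters, one}, fun x => by
    cases x <;> decide⟩

/-- The rank of an element; only `half` and `halfStar` share their rank. -/
def rank : BoolValue → ℕ
  | zero => 0 | quarter => 1 | threeEighths => 2 | half => 3
  | halfStar => 3 | fiveEighths => 4 | threeQuarters => 5 | one => 6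

instance : LE BoolValue := ⟨fun x y => x = y ∨ x.rank < y.rank⟩

instance : DecidableRel ((· ≤ ·) : BoolValue → BoolValue → Prop) := fun x y =>
  inferInstanceAs (Decidable (x = y ∨ x.rank < y.rank))

instance : PartialOrder BoolValue where
  le_refl _ := .inl rfl
  le_trans := by decide +kernel
  le_antisymm := by decide +kernel

/-- The strength of a value as a Left option. -/
def tier : BoolValue → Fin 4
  | zero => 0 | quarter => 0 | threeEighths => 0 | half => 1
  | halfStar => 0 | fiveEighths => 1 | threeQuarters => 2 | one => 3

/-- The strength of a value as a Right option. -/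
def bar : BoolValue → Fin 4
  | zero => 0 | quarter => 1 | threeEighths => 2 | half => 2
  | halfStar => 3 | fiveEighths => 3 | threeQuarters => 3 | one => 3

/-- The integer at `zero` and `one`. -/
def toInt : BoolValue → ℤ
  | one => 1
  | _ => 0

/-- In the even parity, `zero` and `one` are integers. -/
def IsLeaf (i : ZMod 2) (x : BoolValue) : Prop := i = 0 ∧ (x = zero ∨ x = one)

instance (i : ZMod 2) (x : BoolValue) : Decidable (IsLeaf i x) :=
  inferInstanceAs (Decidable (_ ∧ _))

/-- The Left option of the canonical game with a given parity and value. -/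
def left (i : ZMod 2) : BoolValue → BoolValue
  | zero => zero | quarter => half | threeEighths => threeQuarters
  | half => if i = 0 then half else zero
  | halfStar => one | fiveEighths => one | threeQuarters => one | one => one

/-- The Right option of the canonical game with a given parity and value. -/
def right (i : ZMod 2) : BoolValue → BoolValue
  | zero => zero | quarter => zero | threeEighths => zero
  | half => if i = 0 then half else one
  | halfStar => zero | fiveEighths => quarter | threeQuarters => half | one => one

/-- The list of Left options of the canonical game. -/
def lefts (i : ZMod 2) (x : BoolValue) : List BoolValue :=
  if IsLeaf i x then [] else [x.left i]

/-- The list of Right options of the canonical game. -/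
def rights (i : ZMod 2) (x : BoolValue) : List BoolValue :=
  if IsLeaf i x then [] else [x.right i]

/-- The height of the canonical game. -/
def depth (i : ZMod 2) (x : BoolValue) : ℕ :=
  match x with
  | zero => if i = 0 then 0 else 1
  | one => if i = 0 then 0 else 1
  | half => if i = 0 then 2 else 1
  | halfStar => if i = 0 then 2 else 1
  | quarter => if i = 0 then 2 else 3
  | threeQuarters => if i = 0 then 2 else 3
  | threeEighths => if i = 0 then 4 else 3
  | fiveEighths => if i = 0 then 4 else 3

theorem depth_lefts : ∀ (i : ZMod 2) (x : BoolValue), ∀ y ∈ x.lefts i,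
    y.depth (i + 1) < x.depth i := by decide +kernel

theorem depth_rights : ∀ (i : ZMod 2) (x : BoolValue), ∀ y ∈ x.rights i,
    y.depth (i + 1) < x.depth i := by decide +kernel

/-- The value of the game whose best Left option has tier `m` and whose best Right option has
bar `n`. The parameter `s` matters only where an integer has to be chosen. -/
def step (s i : ZMod 2) (m n : Fin 4) : BoolValue :=
  match m, n with
  | 3, 0 => halfStar
  | 3, 1 => fiveEighths
  | 3, 2 => threeQuarters
  | 3, 3 => one
  | 0, 0 => zero
  | 1, 0 => quarter
  | 2, 0 => threeEighths
  | 0, 3 => if i = 0 then (if s = 0 then one else zero) else half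
  | 0, _ => if i = 0 then zero else half
  | _, 3 => if i = 0 then one else half
  | _, _ => half

/-- `1 - x`. -/
def dual : BoolValue → BoolValue
  | zero => one | quarter => threeQuarters | threeEighths => fiveEighths | half => half
  | halfStar => halfStar | fiveEighths => threeEighths | threeQuarters => quarter | one => zero

theorem dual_dual : ∀ x : BoolValue, x.dual.dual = x := by decide

/-- The left outcome of the canonical game. -/
def leftOutcome (i : ZMod 2) (x : BoolValue) : ℤ :=
  if i = 0 then (if x = zero then 0 else 1) else (if x ≤ half then 0 else 1)

/-- The right outcome of the canonical game. -/
def rightOutcome (i : ZMod 2) (x : BoolValue) : ℤ :=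
  if i = 0 then (if x = one then 1 else 0) else (if half ≤ x then 1 else 0)

theorem tier_mono : ∀ {x y : BoolValue}, x ≤ y → x.tier ≤ y.tier := by decide +kernel

theorem bar_mono : ∀ {x y : BoolValue}, x ≤ y → x.bar ≤ y.bar := by decide +kernel

/-- The source of `u⁻ ≤ u⁺`: in the ambiguous case `step 1` takes 0 and `step 0` takes 1. -/
theorem step_mono : ∀ (i : ZMod 2) {m m' n n' : Fin 4}, m ≤ m' → n ≤ n' →
    step 1 i m n ≤ step 0 i m' n' := by decide +kernel

/-- Together with the next three lemmas this says that `step` solves the recursion for values: it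
lies between the Left and the Right options, and the moves of its canonical game are matched by the
best options. -/
theorem le_bar_step : ∀ (s i : ZMod 2) (m n : Fin 4), m ≤ (step s i m n).bar := by
  decide +kernel

theorem tier_step_le : ∀ (s i : ZMod 2) (m n : Fin 4), (step s i m n).tier ≤ n := by
  decide +kernel

theorem lefts_step : ∀ (s i : ZMod 2) (a : BoolValue) (n : Fin 4),
    ∀ z ∈ (step s i a.tier n).lefts i, z ≤ a := by decide +kernel

theorem rights_step : ∀ (s i : ZMod 2) (m : Fin 4) (b : BoolValue),
    ∀ z ∈ (step s i m b.bar).rights i, b ≤ z := by decide +kernel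

/-- This lemma and the next provide the `Bound` clauses when the canonical game is an integer. Each
is needed for one `s` only, which forces the choice made in the ambiguous case. -/
theorem leftOutcome_step : ∀ (m : Fin 4) (b : BoolValue), IsLeaf 0 (step 0 0 m b.bar) →
    b.leftOutcome 1 ≤ (step 0 0 m b.bar).toInt := by decide +kernel

theorem rightOutcome_step : ∀ (a : BoolValue) (n : Fin 4), IsLeaf 0 (step 1 0 a.tier n) →
    (step 1 0 a.tier n).toInt ≤ a.rightOutcome 1 := by decide +kernel

end BoolValue

/-! ### Canonical games -/

namespace ScoringGame

open BoolValue

/-- Auxiliary to `canon`: the first parameter bounds the depth. -/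
def canonAux : ℕ → ZMod 2 → BoolValue → ScoringGame
  | 0, _, x => int x.toInt
  | d + 1, i, x =>
    if IsLeaf i x then int x.toInt
    else node 0 0 (fun _ => canonAux d (i + 1) (x.left i)) (fun _ => canonAux d (i + 1) (x.right i))

/-- The canonical Boolean-valued game with a given parity and value. -/
def canon (i : ZMod 2) (x : BoolValue) : ScoringGame := canonAux (x.depth i) i x

theorem canon_of_isLeaf {i : ZMod 2} {x : BoolValue} (h : IsLeaf i x) :
    canon i x = int x.toInt := by
  unfold canon
  cases x.depth i with
  | zero => rfl
  | succ d => exact if_pos h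

/-- The depth parameter makes the recursion structural, so that canonical games can be evaluated by
the kernel; any sufficiently large bound gives the same game. -/
theorem canonAux_of_depth_le (d : ℕ) (i : ZMod 2) (x : BoolValue) (h : x.depth i ≤ d) :
    canonAux d i x = canon i x := by
  have h0 : ∀ (i : ZMod 2) (x : BoolValue), x.depth i = 0 → IsLeaf i x := by decide +kernel
  induction d using Nat.strong_induction_on generalizing i x with
  | h d ih =>
    by_cases hx : IsLeaf i x
    · rw [canon_of_isLeaf hx]
      cases d with
      | zero => rfl
      | succ d => exact if_pos hx
    · have hl := depth_lefts i x (x.left i) (by simp [lefts, hx])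
      have hr := depth_rights i x (x.right i) (by simp [rights, hx])
      unfold canon
      obtain ⟨e, he⟩ : ∃ e, x.depth i = e + 1 := Nat.exists_eq_succ_of_ne_zero fun h => hx (h0 i x h)
      obtain ⟨d, rfl⟩ : ∃ d', d = d' + 1 := ⟨d - 1, by omega⟩
      rw [he, canonAux, canonAux, if_neg hx, if_neg hx, ih d (by omega) _ _ (by omega),
        ih d (by omega) _ _ (by omega)]
      by_cases hed : e = d
      · subst hed
        rw [ih e (by omega) _ _ (by omega), ih e (by omega) _ _ (by omega)]
      · rw [ih e (by omega) _ _ (by omega), ih e (by omega) _ _ (by omega)]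

theorem canon_of_not_isLeaf {i : ZMod 2} {x : BoolValue} (h : ¬ IsLeaf i x) :
    canon i x =
      node 0 0 (fun _ => canon (i + 1) (x.left i)) (fun _ => canon (i + 1) (x.right i)) := by
  have hl := depth_lefts i x (x.left i) (by simp [lefts, h])
  have hr := depth_rights i x (x.right i) (by simp [rights, h])
  rw [← canonAux_of_depth_le _ i x (Nat.le_succ _), canonAux, if_neg h,
    canonAux_of_depth_le _ _ _ hl.le, canonAux_of_depth_le _ _ _ hr.le]

theorem isLeft_canon {i : ZMod 2} {x : BoolValue} {K : ScoringGame} :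
    IsLeft K (canon i x) ↔ ∃ y ∈ x.lefts i, K = canon (i + 1) y := by
  by_cases h : IsLeaf i x
  · simp [canon_of_isLeaf h, lefts, h, IsLeft]
  · simp [canon_of_not_isLeaf h, lefts, h, IsLeft]

theorem isRight_canon {i : ZMod 2} {x : BoolValue} {K : ScoringGame} :
    IsRight K (canon i x) ↔ ∃ y ∈ x.rights i, K = canon (i + 1) y := by
  by_cases h : IsLeaf i x
  · simp [canon_of_isLeaf h, rights, h, IsRight]
  · simp [canon_of_not_isLeaf h, rights, h, IsRight]

theorem canon_eq_int {i : ZMod 2} {x : BoolValue} {n : ℤ} (h : canon i x = int n) :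
    IsLeaf i x ∧ n = x.toInt := by
  by_cases hx : IsLeaf i x
  · rw [canon_of_isLeaf hx, int.injEq] at h
    exact ⟨hx, h.symm⟩
  · simp [canon_of_not_isLeaf hx] at h

theorem canon_ne_int {i : ZMod 2} {x : BoolValue} (h : ¬ IsLeaf i x) (n : ℤ) :
    canon i x ≠ int n := fun e => h (canon_eq_int e).1

theorem canon_induction {p : ZMod 2 → BoolValue → Prop}
    (h : ∀ i x, (∀ y ∈ x.lefts i, p (i + 1) y) → (∀ y ∈ x.rights i, p (i + 1) y) → p i x)
    (i : ZMod 2) (x : BoolValue) : p i x := by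
  induction hd : x.depth i using Nat.strong_induction_on generalizing i x with
  | h d ih =>
    subst hd
    exact h i x (fun y hy => ih _ (depth_lefts i x y hy) (i + 1) y rfl)
      (fun y hy => ih _ (depth_rights i x y hy) (i + 1) y rfl)

theorem tempered_canon (i : ZMod 2) (x : BoolValue) : (canon i x).Tempered i := by
  induction i, x using canon_induction with
  | h i x ihL ihR =>
    by_cases hx : IsLeaf i x
    · rw [canon_of_isLeaf hx]
      exact hx.1
    · rw [canon_of_not_isLeaf hx]
      exact ⟨fun _ => ihL _ (by simp [lefts, hx]), fun _ => ihR _ (by simp [rights, hx])⟩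

theorem valuedIn_canon (i : ZMod 2) (x : BoolValue) : (canon i x).ValuedIn {0, 1} := by
  induction i, x using canon_induction with
  | h i x ihL ihR =>
    by_cases hx : IsLeaf i x
    · rw [canon_of_isLeaf hx, valuedIn_int]
      cases x <;> simp [toInt]
    · rw [canon_of_not_isLeaf hx, valuedIn_node]
      exact ⟨fun _ => ihL _ (by simp [lefts, hx]), fun _ => ihR _ (by simp [rights, hx])⟩

theorem outcome_canon (i : ZMod 2) (x : BoolValue) :
    (canon i x).leftOutcome = x.leftOutcome i ∧ (canon i x).rightOutcome = x.rightOutcome i := by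
  have h0 : ∀ (i : ZMod 2) (x : BoolValue), IsLeaf i x →
      x.toInt = x.leftOutcome i ∧ x.toInt = x.rightOutcome i := by decide +kernel
  have h1 : ∀ (i : ZMod 2) (x : BoolValue), ¬ IsLeaf i x →
      (x.left i).rightOutcome (i + 1) = x.leftOutcome i ∧
        (x.right i).leftOutcome (i + 1) = x.rightOutcome i := by decide +kernel
  induction i, x using canon_induction with
  | h i x ihL ihR =>
    by_cases hx : IsLeaf i x
    · rw [canon_of_isLeaf hx]
      exact h0 i x hx
    · obtain ⟨K, hK, e⟩ := exists_isLeft (canon_ne_int hx)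
      obtain ⟨K', hK', e'⟩ := exists_isRight (canon_ne_int hx)
      rw [isLeft_canon] at hK
      rw [isRight_canon] at hK'
      obtain ⟨y, hy, rfl⟩ := hK
      obtain ⟨y', hy', rfl⟩ := hK'
      rw [e, e', (ihL y hy).2, (ihR y' hy').1]
      simp only [lefts, rights, hx, if_false, List.mem_singleton] at hy hy'
      subst hy hy'
      exact h1 i x hx

/-- The order and the tier-bar relation satisfy the recursion that defines `Comp`, so induction on
the total depth reduces the claim to finite checks. No dependence on `s` remains. -/
theorem comp_canon (s i : ZMod 2) (x y : BoolValue) :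
    (x ≤ y → Comp s true (canon i x) (canon i y)) ∧
      (x.tier ≤ y.bar → Comp s false (canon i x) (canon (i + 1) y)) := by
  have h1 : ∀ (i : ZMod 2) (x y : BoolValue), x ≤ y →
      (∀ z ∈ x.lefts i, z.tier ≤ y.bar) ∧ (∀ z ∈ y.rights i, x.tier ≤ z.bar) := by
    decide +kernel
  have h3 : ∀ (i : ZMod 2) (x y : BoolValue), x ≤ y →
      (IsLeaf i y → x.rightOutcome i ≤ y.toInt) ∧ (IsLeaf i x → x.toInt ≤ y.leftOutcome i) := by
    decide +kernel
  -- The good move for Left in `y`, or the forced answer to a move for Right in `x`, that justifies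
  -- a comparison across parities.
  have h2 : ∀ (i : ZMod 2) (x y : BoolValue), x.tier ≤ y.bar →
      (∃ z ∈ x.rights i, z ≤ y) ∨ (∃ z ∈ y.lefts (i + 1), x ≤ z) := by decide +kernel
  suffices h : ∀ d i x y,
      (x.depth i + y.depth i = d → x ≤ y → Comp s true (canon i x) (canon i y)) ∧
      (x.depth i + y.depth (i + 1) = d → x.tier ≤ y.bar →
        Comp s false (canon i x) (canon (i + 1) y)) from
    ⟨(h _ i x y).1 rfl, (h _ i x y).2 rfl⟩
  intro d
  induction d using Nat.strong_induction_on with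
  | h d ih =>
    refine fun i x y => ⟨fun hd hxy => ?_, fun hd hxy => ?_⟩
    · obtain ⟨hL, hR⟩ := h1 i x y hxy
      refine .le (fun K hK => ?_) (fun K hK => ?_) ⟨fun hs n hn => ?_, fun hs n hn => ?_⟩
      · obtain ⟨z, hz, rfl⟩ := isLeft_canon.1 hK
        have hz' := depth_lefts i x z hz
        have := (ih (z.depth (i + 1) + y.depth i) (by omega) (i + 1) z y).2
        rw [i.add_one_add_one] at this
        exact this rfl (hL z hz)
      · obtain ⟨z, hz, rfl⟩ := isRight_canon.1 hK
        have hz' := depth_rights i y z hz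
        exact (ih _ (by omega) i x z).2 rfl (hR z hz)
      · obtain ⟨hy, rfl⟩ := canon_eq_int hn
        rw [(outcome_canon i x).2]
        exact (h3 i x y hxy).1 hy
      · obtain ⟨hx, rfl⟩ := canon_eq_int hn
        rw [(outcome_canon i y).1]
        exact (h3 i x y hxy).2 hx
    · rcases h2 i x y hxy with ⟨z, hz, hzy⟩ | ⟨z, hz, hxz⟩
      · have hz' := depth_rights i x z hz
        exact .right (isRight_canon.2 ⟨z, hz, rfl⟩) ((ih _ (by omega) (i + 1) z y).1 rfl hzy)
      · have hz' := depth_lefts (i + 1) y z hz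
        rw [i.add_one_add_one] at hz'
        refine .left (isLeft_canon.2 ⟨z, hz, rfl⟩) ?_
        rw [i.add_one_add_one]
        exact (ih _ (by omega) i x z).1 rfl hxz

/-! ### Values of scoring games for a fixed last player -/

/-- `G` is equivalent to the canonical game with value `x`, as far as play with a given last
player is concerned. -/
structure HasValue (s i : ZMod 2) (G : ScoringGame) (x : BoolValue) : Prop where
  tempered : G.Tempered i
  le : Comp s true G (canon i x)
  ge : Comp s true (canon i x) G

theorem hasValue_canon (s i : ZMod 2) (x : BoolValue) : HasValue s i (canon i x) x :=
  ⟨tempered_canon i x, (comp_canon s i x x).1 le_rfl, (comp_canon s i x x).1 le_rfl⟩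

theorem HasValue.comp {s i : ZMod 2} {G H : ScoringGame} {x y : BoolValue}
    (hG : HasValue s i G x) (hH : HasValue s i H y) (h : x ≤ y) : Comp s true G H :=
  .trans hG.tempered (tempered_canon i x) hH.tempered hG.le <|
    .trans (tempered_canon i x) (tempered_canon i y) hH.tempered ((comp_canon s i x y).1 h) hH.ge

theorem HasValue.comp_lf {s i : ZMod 2} {G H : ScoringGame} {x y : BoolValue}
    (hG : HasValue s i G x) (hH : HasValue s (i + 1) H y) (h : x.tier ≤ y.bar) :
    Comp s false G H :=
  .trans_lf hG.tempered (tempered_canon i x) hH.tempered hG.le <|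
    .lf_trans (tempered_canon i x) (tempered_canon (i + 1) y) hH.tempered
      ((comp_canon s i x y).2 h) hH.ge

/-- A value for `s` sees only plays with the corresponding last player: the right outcome at parity
`s` and, in the next lemma, the left outcome at parity `s + 1`. -/
theorem HasValue.rightOutcome_eq {s : ZMod 2} {G : ScoringGame} {x : BoolValue}
    (h : HasValue s s G x) : G.rightOutcome = x.rightOutcome s :=
  (outcome_canon s x).2 ▸ le_antisymm (h.le.rightOutcome_le h.tempered (tempered_canon s x))
    (h.ge.rightOutcome_le (tempered_canon s x) h.tempered)

theorem HasValue.leftOutcome_eq {s : ZMod 2} {G : ScoringGame} {x : BoolValue}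
    (h : HasValue s (s + 1) G x) : G.leftOutcome = x.leftOutcome (s + 1) :=
  (outcome_canon (s + 1) x).1 ▸
    le_antisymm (h.le.leftOutcome_le h.tempered (tempered_canon (s + 1) x))
      (h.ge.leftOutcome_le (tempered_canon (s + 1) x) h.tempered)

/-- The value of a game is determined by the tiers of its Left options and the bars of its Right
options. -/
theorem hasValue_of_options {s i : ZMod 2} {G : ScoringGame} (hG : G.Tempered i) {m n : Fin 4}
    (hL : ∀ K, IsLeft K G → ∃ a, HasValue s (i + 1) K a ∧ a.tier ≤ m)
    (hL' : ∃ K a, IsLeft K G ∧ HasValue s (i + 1) K a ∧ a.tier = m)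
    (hR : ∀ K, IsRight K G → ∃ b, HasValue s (i + 1) K b ∧ n ≤ b.bar)
    (hR' : ∃ K b, IsRight K G ∧ HasValue s (i + 1) K b ∧ b.bar = n) :
    HasValue s i G (step s i m n) := by
  obtain ⟨A, a, hA, hAa, rfl⟩ := hL'
  obtain ⟨B, b, hB, hBb, rfl⟩ := hR'
  have hz := hasValue_canon s i (step s i a.tier b.bar)
  refine ⟨hG, .le (fun K hK => ?_) (fun K hK => ?_) ⟨?_, ?_⟩,
    .le (fun K hK => ?_) (fun K hK => ?_) ⟨?_, ?_⟩⟩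
  · obtain ⟨c, hc, hcm⟩ := hL K hK
    -- The option `K` has parity `i + 1`, so the game it is compared with must be read at parity `i
    -- + 1 + 1`.
    rw [← i.add_one_add_one] at hz
    exact hc.comp_lf (by rwa [i.add_one_add_one] at hz ⊢)
      (hcm.trans (by simpa only [i.add_one_add_one] using le_bar_step s i _ _))
  · obtain ⟨z, hz', rfl⟩ := isRight_canon.1 hK
    exact .right hB (hBb.comp (hasValue_canon s (i + 1) z) (rights_step _ _ _ _ z hz'))
  · rintro rfl c hc
    obtain ⟨hz', rfl⟩ := canon_eq_int hc
    obtain rfl := hz'.1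
    -- Right's best option already brings the score down to the integer.
    refine (rightOutcome_le_leftOutcome_of_isRight hB).trans ?_
    rw [hBb.leftOutcome_eq]
    exact leftOutcome_step _ _ hz'
  · rintro rfl c rfl
    exact hA.elim
  · obtain ⟨z, hz', rfl⟩ := isLeft_canon.1 hK
    exact .left hA ((hasValue_canon s (i + 1) z).comp hAa (lefts_step _ _ _ _ z hz'))
  · obtain ⟨c, hc, hcm⟩ := hR K hK
    exact hz.comp_lf hc ((tier_step_le s i _ _).trans hcm)
  · rintro rfl c rfl
    exact hA.elim
  · rintro rfl c hc
    obtain ⟨hz', rfl⟩ := canon_eq_int hc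
    obtain rfl := hz'.1
    refine le_trans ?_ (rightOutcome_le_leftOutcome_of_isLeft hA)
    rw [zero_add] at hAa
    rw [hAa.rightOutcome_eq]
    exact rightOutcome_step _ _ hz'

/-! ### Sums of canonical games as tests -/

theorem forall_isLeft_canon_add {i j : ZMod 2} {x w : BoolValue} {p : ScoringGame → Prop} :
    (∀ K, IsLeft K (canon i x + canon j w) → p K) ↔
      (∀ y ∈ x.lefts i, p (canon (i + 1) y + canon j w)) ∧
        (∀ v ∈ w.lefts j, p (canon i x + canon (j + 1) v)) := by
  constructor
  · exact fun h => ⟨fun y hy => h _ (isLeft_ext2.2 (.inl ⟨_, isLeft_canon.2 ⟨y, hy, rfl⟩, rfl⟩)),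
      fun v hv => h _ (isLeft_ext2.2 (.inr ⟨_, isLeft_canon.2 ⟨v, hv, rfl⟩, rfl⟩))⟩
  · rintro ⟨h, h'⟩ K hK
    rcases isLeft_ext2.1 hK with ⟨_, hy, rfl⟩ | ⟨_, hv, rfl⟩
    · obtain ⟨y, hm, rfl⟩ := isLeft_canon.1 hy
      exact h y hm
    · obtain ⟨v, hm, rfl⟩ := isLeft_canon.1 hv
      exact h' v hm

theorem exists_isLeft_canon_add {i j : ZMod 2} {x w : BoolValue} {p : ScoringGame → Prop} :
    (∃ K, IsLeft K (canon i x + canon j w) ∧ p K) ↔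
      (∃ y ∈ x.lefts i, p (canon (i + 1) y + canon j w)) ∨
        (∃ v ∈ w.lefts j, p (canon i x + canon (j + 1) v)) := by
  constructor
  · rintro ⟨K, hK, h⟩
    rcases isLeft_ext2.1 hK with ⟨_, hy, rfl⟩ | ⟨_, hv, rfl⟩
    · obtain ⟨y, hm, rfl⟩ := isLeft_canon.1 hy
      exact .inl ⟨y, hm, h⟩
    · obtain ⟨v, hm, rfl⟩ := isLeft_canon.1 hv
      exact .inr ⟨v, hm, h⟩
  · rintro (⟨y, hy, h⟩ | ⟨v, hv, h⟩)
    · exact ⟨_, isLeft_ext2.2 (.inl ⟨_, isLeft_canon.2 ⟨y, hy, rfl⟩, rfl⟩), h⟩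
    · exact ⟨_, isLeft_ext2.2 (.inr ⟨_, isLeft_canon.2 ⟨v, hv, rfl⟩, rfl⟩), h⟩

theorem forall_isRight_canon_add {i j : ZMod 2} {x w : BoolValue} {p : ScoringGame → Prop} :
    (∀ K, IsRight K (canon i x + canon j w) → p K) ↔
      (∀ y ∈ x.rights i, p (canon (i + 1) y + canon j w)) ∧
        (∀ v ∈ w.rights j, p (canon i x + canon (j + 1) v)) := by
  constructor
  · exact fun h => ⟨fun y hy => h _ (isRight_ext2.2 (.inl ⟨_, isRight_canon.2 ⟨y, hy, rfl⟩, rfl⟩)),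
      fun v hv => h _ (isRight_ext2.2 (.inr ⟨_, isRight_canon.2 ⟨v, hv, rfl⟩, rfl⟩))⟩
  · rintro ⟨h, h'⟩ K hK
    rcases isRight_ext2.1 hK with ⟨_, hy, rfl⟩ | ⟨_, hv, rfl⟩
    · obtain ⟨y, hm, rfl⟩ := isRight_canon.1 hy
      exact h y hm
    · obtain ⟨v, hm, rfl⟩ := isRight_canon.1 hv
      exact h' v hm

theorem exists_isRight_canon_add {i j : ZMod 2} {x w : BoolValue} {p : ScoringGame → Prop} :
    (∃ K, IsRight K (canon i x + canon j w) ∧ p K) ↔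
      (∃ y ∈ x.rights i, p (canon (i + 1) y + canon j w)) ∨
        (∃ v ∈ w.rights j, p (canon i x + canon (j + 1) v)) := by
  constructor
  · rintro ⟨K, hK, h⟩
    rcases isRight_ext2.1 hK with ⟨_, hy, rfl⟩ | ⟨_, hv, rfl⟩
    · obtain ⟨y, hm, rfl⟩ := isRight_canon.1 hy
      exact .inl ⟨y, hm, h⟩
    · obtain ⟨v, hm, rfl⟩ := isRight_canon.1 hv
      exact .inr ⟨v, hm, h⟩
  · rintro (⟨y, hy, h⟩ | ⟨v, hv, h⟩)
    · exact ⟨_, isRight_ext2.2 (.inl ⟨_, isRight_canon.2 ⟨y, hy, rfl⟩, rfl⟩), h⟩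
    · exact ⟨_, isRight_ext2.2 (.inr ⟨_, isRight_canon.2 ⟨v, hv, rfl⟩, rfl⟩), h⟩

/-- The outcomes of the sums of two canonical games. -/
theorem outcome_canon_add_canon (i j : ZMod 2) (x w : BoolValue) :
    (i = j → (1 ≤ (canon i x + canon j w).rightOutcome ↔ w.dual ≤ x) ∧
      ((canon i x + canon j w).leftOutcome ≤ 1 ↔ x ≤ w.dual)) ∧
    (i ≠ j → (1 ≤ (canon i x + canon j w).leftOutcome ↔ w.dual.tier ≤ x.bar) ∧
      ((canon i x + canon j w).rightOutcome ≤ 1 ↔ x.tier ≤ w.dual.bar)) := by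
  -- Since `dual` plays the role of `1 - x`, the threshold 1 for the sum compares `x` with `w.dual`.
  -- The two relations `≤` and `tier ≤ bar` alternate with the parity, and the three tables are the
  -- base case and the two kinds of recursion step.
  have h0 : ∀ (i j : ZMod 2) (x w : BoolValue), IsLeaf i x → IsLeaf j w →
      (1 ≤ x.toInt + w.toInt ↔ w.dual ≤ x) ∧ (x.toInt + w.toInt ≤ 1 ↔ x ≤ w.dual) := by
    decide +kernel
  have h1 : ∀ (i : ZMod 2) (x w : BoolValue), ¬ (IsLeaf i x ∧ IsLeaf i w) →
      (w.dual ≤ x ↔ (∀ y ∈ x.rights i, w.dual.tier ≤ y.bar) ∧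
        (∀ v ∈ w.rights i, v.dual.tier ≤ x.bar)) ∧
      (x ≤ w.dual ↔ (∀ y ∈ x.lefts i, y.tier ≤ w.dual.bar) ∧
        (∀ v ∈ w.lefts i, x.tier ≤ v.dual.bar)) := by
    decide +kernel
  have h2 : ∀ (i : ZMod 2) (x w : BoolValue),
      (w.dual.tier ≤ x.bar ↔ (∃ y ∈ x.lefts i, w.dual ≤ y) ∨
        (∃ v ∈ w.lefts (i + 1), v.dual ≤ x)) ∧
      (x.tier ≤ w.dual.bar ↔ (∃ y ∈ x.rights i, y ≤ w.dual) ∨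
        (∃ v ∈ w.rights (i + 1), x ≤ v.dual)) := by
    decide +kernel
  induction hd : x.depth i + w.depth j using Nat.strong_induction_on generalizing i j x w with
  | h d ih =>
  have hlx := depth_lefts i x
  have hlw := depth_lefts j w
  have hrx := depth_rights i x
  have hrw := depth_rights j w
  by_cases hlf : IsLeaf i x ∧ IsLeaf j w
  · refine ⟨fun _ => ?_, fun h => (h (hlf.1.1.trans hlf.2.1.symm)).elim⟩
    rw [canon_of_isLeaf hlf.1, canon_of_isLeaf hlf.2]
    exact h0 i j x w hlf.1 hlf.2
  · have hn : ∀ c, canon i x + canon j w ≠ int c := fun c hc => by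
      obtain ⟨m, n, hm, hn, -⟩ := ext2_eq_int_iff.1 hc
      exact hlf ⟨(canon_eq_int hm).1, (canon_eq_int hn).1⟩
    constructor
    · rintro rfl
      rw [le_rightOutcome_iff hn, leftOutcome_le_iff hn, (h1 i x w hlf).1, (h1 i x w hlf).2,
        forall_isRight_canon_add, forall_isLeft_canon_add]
      exact ⟨and_congr
          (forall₂_congr fun y hy => ((ih _ (by grind) (i + 1) i y w rfl).2 i.add_one_ne).1)
          (forall₂_congr fun v hv => ((ih _ (by grind) i (i + 1) x v rfl).2 i.add_one_ne.symm).1),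
        and_congr
          (forall₂_congr fun y hy => ((ih _ (by grind) (i + 1) i y w rfl).2 i.add_one_ne).2)
          (forall₂_congr fun v hv => ((ih _ (by grind) i (i + 1) x v rfl).2 i.add_one_ne.symm).2)⟩
    · intro hij
      obtain rfl := ZMod.add_one_eq_of_ne hij
      rw [le_leftOutcome_iff hn, rightOutcome_le_iff hn, (h2 i x w).1, (h2 i x w).2,
        exists_isRight_canon_add, exists_isLeft_canon_add]
      exact ⟨or_congr
          (exists_congr fun y => and_congr_right fun hy =>
            ((ih _ (by grind) (i + 1) (i + 1) y w rfl).1 rfl).1)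
          (exists_congr fun v => and_congr_right fun hv =>
            ((ih _ (by grind) i (i + 1 + 1) x v rfl).1 i.add_one_add_one.symm).1),
        or_congr
          (exists_congr fun y => and_congr_right fun hy =>
            ((ih _ (by grind) (i + 1) (i + 1) y w rfl).1 rfl).2)
          (exists_congr fun v => and_congr_right fun hv =>
            ((ih _ (by grind) i (i + 1 + 1) x v rfl).1 i.add_one_add_one.symm).2)⟩

theorem HasValue.add_canon {s i j : ZMod 2} {G : ScoringGame} {x : BoolValue}
    (h : HasValue s i G x) (w : BoolValue) :
    Comp s true (G + canon j w) (canon i x + canon j w) ∧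
      Comp s true (canon i x + canon j w) (G + canon j w) :=
  ⟨h.le.ext2_left (fun n _ _ h => add_le_add_left h n) _,
    h.ge.ext2_left (fun n _ _ h => add_le_add_left h n) _⟩

/-- Games that are comparable in all contexts have comparable values. -/
theorem HasValue.le_of_lesssim {s i : ZMod 2} {G H : ScoringGame} {x y : BoolValue}
    (hG : HasValue s i G x) (hH : HasValue s i H y) (h : Lesssim G H) : x ≤ y := by
  have ht : ∀ {K : ScoringGame} (w : BoolValue), K.Tempered i →
      (K + canon i w).Tempered 0 := fun w hK =>
    CharTwo.add_self_eq_zero i ▸ hK.ext2 (fun a b => a + b) (tempered_canon i w)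
  have hw : ∀ w : BoolValue, (canon i w).WellTempered := fun w => by
    have := tempered_canon i w
    rcases i.eq_zero_or_eq_one with rfl | rfl
    · exact .inl this
    · exact .inr this
  rcases s.eq_zero_or_eq_one with rfl | rfl
  -- The test game is the dual of the smaller value: its sum with `x` reaches 1 when Right starts,
  -- hence so does its sum with `y`. The sum is even-tempered, so `s = 0` sees its right outcome.
  · have h1 := (hG.add_canon (j := i) x.dual).2.rightOutcome_le (ht _ (tempered_canon i x))
      (ht _ hG.tempered)
    have h2 := (hH.add_canon (j := i) x.dual).1.rightOutcome_le (ht _ hH.tempered)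
      (ht _ (tempered_canon i y))
    have h3 := (((outcome_canon_add_canon i i x x.dual).1 rfl).1).2 (dual_dual x).le
    have h4 := (((outcome_canon_add_canon i i y x.dual).1 rfl).1).1
      (h3.trans (h1.trans ((h _ (hw _)).2.trans h2)))
    rwa [dual_dual] at h4
  -- For `s = 1` the left outcome is visible, and the test is the dual of the larger value.
  · have h1 := (hG.add_canon (j := i) y.dual).2.leftOutcome_le (ht _ (tempered_canon i x))
      (ht _ hG.tempered)
    have h2 := (hH.add_canon (j := i) y.dual).1.leftOutcome_le (ht _ hH.tempered)
      (ht _ (tempered_canon i y))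
    have h3 := (((outcome_canon_add_canon i i y y.dual).1 rfl).2).2 (dual_dual y).ge
    have h4 := (((outcome_canon_add_canon i i x y.dual).1 rfl).2).1
      (h1.trans ((h _ (hw _)).1.trans (h2.trans h3)))
    rwa [dual_dual] at h4

theorem HasValue.unique {s i : ZMod 2} {G : ScoringGame} {x y : BoolValue}
    (h : HasValue s i G x) (h' : HasValue s i G y) : x = y :=
  le_antisymm (h.le_of_lesssim h' fun _ _ => ⟨le_rfl, le_rfl⟩)
    (h'.le_of_lesssim h fun _ _ => ⟨le_rfl, le_rfl⟩)

end ScoringGame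

/-! ### Partizan values of canonical games -/

namespace PGame

/-- Auxiliary to `cmpBool`: the recursion on the second game. -/
def cmpBoolAux {l r : ℕ} (cL : Fin l → PGame → Bool × Bool) (cR : Fin r → PGame → Bool × Bool) :
    PGame → Bool × Bool
  | mk l' r' L' R' =>
    (decide (∀ i, (cL i (mk l' r' L' R')).2 = false) &&
      decide (∀ j, (cmpBoolAux cL cR (R' j)).2 = false),
     decide (∀ i, (cmpBoolAux cL cR (L' i)).1 = false) &&
      decide (∀ j, (cR j (mk l' r' L' R')).1 = false))

/-- The Boolean version of `cmp`, a decision procedure for the order. -/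
def cmpBool : PGame → PGame → Bool × Bool
  | mk _ _ L R => cmpBoolAux (fun i => cmpBool (L i)) (fun j => cmpBool (R j))

theorem cmpBool_iff (G H : PGame) :
    ((cmpBool G H).1 = true ↔ (cmp G H).1) ∧ ((cmpBool G H).2 = true ↔ (cmp G H).2) := by
  induction G generalizing H with
  | mk l r L R ihL ihR =>
    induction H with
    | mk l' r' L' R' ihL' ihR' =>
      have h1 : ∀ j, (cmpBoolAux (fun i => cmpBool (L i)) (fun j => cmpBool (R j)) (R' j)).2 = false
          ↔ ¬ (cmpAux (fun i => cmp (L i)) (fun j => cmp (R j)) (R' j)).2 := fun j =>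
        Bool.eq_false_iff.trans (not_congr (ihR' j).2)
      have h2 : ∀ j, (cmpBoolAux (fun i => cmpBool (L i)) (fun j => cmpBool (R j)) (L' j)).1 = false
          ↔ ¬ (cmpAux (fun i => cmp (L i)) (fun j => cmp (R j)) (L' j)).1 := fun j =>
        Bool.eq_false_iff.trans (not_congr (ihL' j).1)
      simp only [cmpBool, cmpBoolAux, cmp, cmpAux, Bool.and_eq_true, decide_eq_true_eq, h1, h2,
        Bool.eq_false_iff, ne_eq, ihL, ihR, and_self]

/-- Turns the comparisons of the finitely many concrete partizan games below into kernel
computations. -/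
instance : DecidableRel ((· ≤ ·) : PGame → PGame → Prop) := fun G H =>
  decidable_of_iff ((cmpBool G H).1 = true) (cmpBool_iff G H).1

theorem not_le_of_le_left {l r : ℕ} {L : Fin l → PGame} {R : Fin r → PGame} {H : PGame} {k : Fin l}
    (h : H ≤ L k) : ¬ mk l r L R ≤ H := by
  cases H with
  | mk l' r' L' R' => exact fun h' => ((mk_le_mk ..).1 h').1 k h

theorem not_le_of_right_le {l r : ℕ} {L : Fin l → PGame} {R : Fin r → PGame} {H : PGame} {k : Fin r}
    (h : R k ≤ H) : ¬ H ≤ mk l r L R := by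
  cases H with
  | mk l' r' L' R' => exact fun h' => ((mk_le_mk ..).1 h').2 k h

theorem ofNat_mono {m n : ℕ} (h : m ≤ n) : ofNat m ≤ ofNat n := by
  induction m generalizing n with
  | zero => cases n <;> exact (mk_le_mk ..).2 ⟨fun i => i.elim0, fun j => j.elim0⟩
  | succ m ih =>
    obtain ⟨n, rfl⟩ : ∃ k, n = k + 1 := ⟨n - 1, by omega⟩
    refine (mk_le_mk ..).2 ⟨fun i h' => ?_, fun j => j.elim0⟩
    rw [Fin.fin_one_eq_zero i] at h'
    exact not_le_of_le_left (k := 0) (ih (by omega : m ≤ n)) h'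

theorem neg_ofNat_anti {m n : ℕ} (h : m ≤ n) : -ofNat n ≤ -ofNat m := by
  induction m generalizing n with
  | zero => cases n <;> exact (mk_le_mk ..).2 ⟨fun i => i.elim0, fun j => j.elim0⟩
  | succ m ih =>
    obtain ⟨n, rfl⟩ : ∃ k, n = k + 1 := ⟨n - 1, by omega⟩
    refine (mk_le_mk ..).2 ⟨fun i => i.elim0, fun j h' => ?_⟩
    rw [Fin.fin_one_eq_zero j] at h'
    exact not_le_of_right_le (k := 0) (ih (by omega : m ≤ n)) h'

end PGame

namespace BoolValue

/-- The partizan game named by an element. -/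
def toPGame : BoolValue → PGame
  | zero => 0 | quarter => .quarter | threeEighths => .threeEighths | half => .half
  | halfStar => .half + .star | fiveEighths => .fiveEighths
  | threeQuarters => .threeQuarters | one => 1

/-- The value of the canonical game. -/
def val (i : ZMod 2) (x : BoolValue) : PGame := (ScoringGame.canon i x).psi

theorem toPGame_le_toPGame : ∀ {x y : BoolValue}, x.toPGame ≤ y.toPGame ↔ x ≤ y := by
  decide +kernel

theorem val_le_val : ∀ {i : ZMod 2} {x y : BoolValue}, val i x ≤ val i y ↔ x ≤ y := by
  decide +kernel

/-- The link between the two theories: across parities, the partizan order is described by the same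
tier-bar table that governs `Comp`. -/
theorem val_add_one_le_val : ∀ {i : ZMod 2} {x y : BoolValue},
    val (i + 1) y ≤ val i x ↔ ¬ x.tier ≤ y.bar := by
  decide +kernel

theorem val_le_val_add_one {i : ZMod 2} {x y : BoolValue} :
    val i y ≤ val (i + 1) x ↔ ¬ x.tier ≤ y.bar := by
  have h := val_add_one_le_val (i := i + 1) (x := x) (y := y)
  rwa [i.add_one_add_one] at h

theorem neg_one_le_val : ∀ (i : ZMod 2) (x : BoolValue), PGame.ofInt (-1) ≤ val i x := by
  decide +kernel

theorem val_le_two : ∀ (i : ZMod 2) (x : BoolValue), val i x ≤ PGame.ofInt 2 := by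
  decide +kernel

/-- Overheating enters through this finite check alone; elsewhere the values are those of the
canonical games. -/
theorem parityOverheat_equiv : ∀ (i : ZMod 2) (x : BoolValue),
    PGame.parityOverheat i x.toPGame ≤ val i x ∧ val i x ≤ PGame.parityOverheat i x.toPGame := by
  decide +kernel

theorem val_of_isLeaf {i : ZMod 2} {x : BoolValue} (h : IsLeaf i x) :
    val i x = PGame.ofInt x.toInt := by
  rw [val, ScoringGame.canon_of_isLeaf h]
  rfl

theorem val_of_not_isLeaf {i : ZMod 2} {x : BoolValue} (h : ¬ IsLeaf i x) :
    val i x =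
      PGame.mk 1 1 (fun _ => val (i + 1) (x.left i)) (fun _ => val (i + 1) (x.right i)) := by
  rw [val, ScoringGame.canon_of_not_isLeaf h]
  rfl

theorem step_eq_one : ∀ m n : Fin 4, step 1 0 m n = one → ¬ m ≤ bar zero := by decide +kernel

/-- `G` has the same value as the canonical game. -/
def Represents (i : ZMod 2) (x : BoolValue) (G : PGame) : Prop := G ≤ val i x ∧ val i x ≤ G

/-- Conway's comparison of `{L | R}` with the canonical value: each side is refuted by the best
option. In the ambiguous case the braces give the simplest number between the options, which is 0,
hence `step 1`. -/
theorem represents_mk {i : ZMod 2} {l r : ℕ} {L : Fin l → PGame} {R : Fin r → PGame}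
    {x : Fin l → BoolValue} {y : Fin r → BoolValue} (hL : ∀ k, Represents (i + 1) (x k) (L k))
    (hR : ∀ k, Represents (i + 1) (y k) (R k)) {k : Fin l} {k' : Fin r}
    (hk : ∀ a, (x a).tier ≤ (x k).tier) (hk' : ∀ b, (y k').bar ≤ (y b).bar) :
    Represents i (step 1 i (x k).tier (y k').bar) (PGame.mk l r L R) := by
  have hlt : ∀ a, ¬ val i (step 1 i (x k).tier (y k').bar) ≤ L a := fun a h => by
    have h' := h.trans (hL a).1
    rw [val_le_val_add_one] at h'
    exact h' ((hk a).trans (le_bar_step _ _ _ _))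
  have hgt : ∀ b, ¬ R b ≤ val i (step 1 i (x k).tier (y k').bar) := fun b h => by
    have h' := (hR b).2.trans h
    rw [val_add_one_le_val] at h'
    exact h' ((tier_step_le _ _ _ _).trans (hk' b))
  have hlefts := lefts_step 1 i (x k) (y k').bar
  have hrights := rights_step 1 i (x k).tier (y k')
  have hone : i = 0 → step 1 i (x k).tier (y k').bar = one →
      ¬ (x k).tier ≤ bar zero := fun hi => hi ▸ step_eq_one _ _
  revert hlt hgt hlefts hrights hone
  generalize step 1 i (x k).tier (y k').bar = z
  intro hlt hgt hlefts hrights hone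
  by_cases hz : IsLeaf i z
  · obtain ⟨rfl, rfl | rfl⟩ := hz
    · exact ⟨(PGame.mk_le_mk ..).2 ⟨hlt, fun j => j.elim0⟩,
        (PGame.mk_le_mk ..).2 ⟨fun j => j.elim0, hgt⟩⟩
    · refine ⟨(PGame.mk_le_mk ..).2 ⟨hlt, fun j => j.elim0⟩,
        (PGame.mk_le_mk ..).2 ⟨fun j => ?_, hgt⟩⟩
      rw [Fin.fin_one_eq_zero j]
      -- For `1 = {0 | }` the game must not be `≤ 0`; a Left option of positive tier is `≥ 0` and
      -- shows this.
      refine PGame.not_le_of_le_left (k := k) (le_trans ?_ (hL k).2)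
      exact (val_le_val_add_one (i := 0) (y := zero)).2 (hone rfl rfl)
  · simp only [lefts, rights, hz, if_false, List.mem_singleton, forall_eq] at hlefts hrights
    have e := val_of_not_isLeaf hz
    constructor
    · rw [e]
      rw [e] at hlt
      exact (PGame.mk_le_mk ..).2 ⟨hlt, fun _ =>
        PGame.not_le_of_right_le (k := k') ((hR k').1.trans (val_le_val.2 hrights))⟩
    · rw [e]
      rw [e] at hgt
      exact (PGame.mk_le_mk ..).2 ⟨fun _ =>
        PGame.not_le_of_le_left (k := k) ((val_le_val.2 hlefts).trans (hL k).2), hgt⟩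

/-- All values lie in `[-1, 2]`, which excludes integers other than 0 and 1. These two are
themselves even-parity values and bound all the others, so they fit only between odd-parity options.
-/
theorem mem_integersBetween {i : ZMod 2} {l r : ℕ} {L : Fin l → PGame} {R : Fin r → PGame}
    {x : Fin l → BoolValue} {y : Fin r → BoolValue} (hL : ∀ k, Represents (i + 1) (x k) (L k))
    (hR : ∀ k, Represents (i + 1) (y k) (R k)) {k : Fin l} {k' : Fin r}
    (hk : ∀ a, (x a).tier ≤ (x k).tier) (hk' : ∀ b, (y k').bar ≤ (y b).bar) (n : ℤ) :
    n ∈ PGame.integersBetween L R ↔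
      i = 0 ∧ (n = 0 ∧ (x k).tier = 0 ∨ n = 1 ∧ (y k').bar = 3) := by
  have hmem : n ∈ PGame.integersBetween L R ↔
      (∀ a, ¬ PGame.ofInt n ≤ val (i + 1) (x a)) ∧ (∀ b, ¬ val (i + 1) (y b) ≤ PGame.ofInt n) :=
    and_congr
      (forall_congr' fun a => not_congr ⟨fun h => h.trans (hL a).1, fun h => h.trans (hL a).2⟩)
      (forall_congr' fun b => not_congr ⟨(hR b).2.trans, (hR b).1.trans⟩)
  have h0 : PGame.ofInt 0 = val 0 zero := (val_of_isLeaf (i := 0) ⟨rfl, .inl rfl⟩).symm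
  have h1 : PGame.ofInt 1 = val 0 one := (val_of_isLeaf (i := 0) ⟨rfl, .inr rfl⟩).symm
  have hz : ∀ a : BoolValue, zero ≤ a ∧ a ≤ one ∧ a.tier ≤ bar one ∧ tier zero ≤ a.bar := by
    decide
  rw [hmem]
  rcases lt_or_ge n 0 with hn | hn
  · refine iff_of_false (fun h => h.1 k (le_trans ?_ (neg_one_le_val _ _))) (by omega)
    obtain ⟨c, rfl⟩ := Int.eq_negSucc_of_lt_zero hn
    exact PGame.neg_ofNat_anti (show 1 ≤ c + 1 by omega)
  rcases lt_or_ge 1 n with hn' | hn'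
  · refine iff_of_false (fun h => h.2 k' ((val_le_two _ _).trans ?_)) (by omega)
    obtain ⟨c, rfl⟩ := Int.eq_ofNat_of_zero_le hn
    exact PGame.ofNat_mono (show 2 ≤ c by omega)
  obtain rfl | rfl : n = 0 ∨ n = 1 := by omega
  · rw [h0]
    rcases i.eq_zero_or_eq_one with rfl | rfl
    · simp only [val_le_val_add_one, val_add_one_le_val, not_not, hz, implies_true, and_true, true_and,
        zero_ne_one, false_and, or_false]
      exact ⟨fun h => Fin.le_zero_iff.1 (h k), fun h a => (hk a).trans h.le⟩
    · exact iff_of_false (fun h => h.1 k (val_le_val.2 (hz _).1)) (by simp)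
  · rw [h1]
    rcases i.eq_zero_or_eq_one with rfl | rfl
    · simp only [val_le_val_add_one, val_add_one_le_val, not_not, hz, implies_true, true_and,
        one_ne_zero, false_and, false_or]
      exact ⟨fun h => le_antisymm (Fin.le_last _) (h k'), fun h b => h.ge.trans (hk' b)⟩
    · exact iff_of_false (fun h => h.2 k' (val_le_val.2 (hz _).2.1)) (by simp)

/-- If an integer fits, the largest and the smallest one are read off from whether `n = 3` and `m =
0`. Otherwise the braces are ordinary and `step` does not depend on `s`. -/
theorem represents_braces {i : ZMod 2} {l r : ℕ} {L : Fin l → PGame} {R : Fin r → PGame}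
    {x : Fin l → BoolValue} {y : Fin r → BoolValue} (hL : ∀ k, Represents (i + 1) (x k) (L k))
    (hR : ∀ k, Represents (i + 1) (y k) (R k)) {k : Fin l} {k' : Fin r}
    (hk : ∀ a, (x a).tier ≤ (x k).tier) (hk' : ∀ b, (y k').bar ≤ (y b).bar) :
    Represents i (step 0 i (x k).tier (y k').bar) (PGame.bracesPlus L R) ∧
      Represents i (step 1 i (x k).tier (y k').bar) (PGame.bracesMinus L R) := by
  have hmem := mem_integersBetween hL hR hk hk'
  have hmk := represents_mk hL hR hk hk'
  generalize (x k).tier = m at *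
  generalize (y k').bar = n at *
  have hint : ∀ z : BoolValue, IsLeaf i z → Represents i z (PGame.ofInt z.toInt) := fun z hz => by
    rw [← val_of_isLeaf hz]
    exact ⟨le_rfl, le_rfl⟩
  by_cases h : i = 0 ∧ (m = 0 ∨ n = 3)
  · obtain ⟨rfl, h⟩ := h
    have hne : (PGame.integersBetween L R).Nonempty := by
      rcases h with h | h
      · exact ⟨0, (hmem 0).2 ⟨rfl, .inl ⟨rfl, h⟩⟩⟩
      · exact ⟨1, (hmem 1).2 ⟨rfl, .inr ⟨rfl, h⟩⟩⟩
    have hs : ∀ s : ZMod 2, IsLeaf 0 (step s 0 m n) := by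
      clear * - h
      revert m n
      decide +kernel
    have hmax : ∀ m n : Fin 4, (m = 0 ∨ n = 3) →
        (n = 3 → (step 0 0 m n).toInt = 1) ∧ (n ≠ 3 → (step 0 0 m n).toInt = 0) ∧
          (m = 0 → (step 1 0 m n).toInt = 0) ∧ (m ≠ 0 → (step 1 0 m n).toInt = 1) := by
      decide +kernel
    obtain ⟨e1, e2, e3, e4⟩ := hmax m n h
    rw [PGame.bracesPlus, PGame.bracesMinus, if_pos hne, if_pos hne]
    have hsup : IsGreatest (PGame.integersBetween L R) (step 0 0 m n).toInt := by
      refine ⟨(hmem _).2 ⟨rfl, ?_⟩, fun c hc => ?_⟩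
      · by_cases hn : n = 3
        · exact .inr ⟨e1 hn, hn⟩
        · exact .inl ⟨e2 hn, h.resolve_right hn⟩
      · by_cases hn : n = 3
        · have := (hmem c).1 hc
          rw [e1 hn]
          omega
        · have := (hmem c).1 hc
          rw [e2 hn]
          omega
    have hinf : IsLeast (PGame.integersBetween L R) (step 1 0 m n).toInt := by
      refine ⟨(hmem _).2 ⟨rfl, ?_⟩, fun c hc => ?_⟩
      · by_cases hm : m = 0
        · exact .inl ⟨e3 hm, hm⟩
        · exact .inr ⟨e4 hm, h.resolve_left hm⟩
      · by_cases hm : m = 0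
        · have := (hmem c).1 hc
          rw [e3 hm]
          omega
        · have := (hmem c).1 hc
          rw [e4 hm]
          omega
    rw [hsup.csSup_eq, hinf.csInf_eq]
    exact ⟨hint _ (hs 0), hint _ (hs 1)⟩
  · have hne : ¬ (PGame.integersBetween L R).Nonempty := fun ⟨c, hc⟩ =>
      h (((hmem c).1 hc).imp_right fun h => h.imp And.right And.right)
    have hs : step 0 i m n = step 1 i m n := by
      clear * - h
      revert i m n
      decide +kernel
    rw [PGame.bracesPlus, PGame.bracesMinus, if_neg hne, if_neg hne, hs]
    exact ⟨hmk, hmk⟩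

end BoolValue

/-! ### Existence of the values -/

namespace ScoringGame

open BoolValue

/-- Outcome values and partizan values satisfy the same `step` recursion, so one induction
constructs both and identifies them. -/
theorem exists_values {G : ScoringGame} {i : ZMod 2} (hG : G.Tempered i)
    (hv : G.ValuedIn {0, 1}) :
    ∃ p x y : BoolValue, y ≤ x ∧ HasValue 0 i G x ∧ HasValue 1 i G y ∧
      Represents i p G.psi ∧ Represents i x G.psiPlus ∧ Represents i y G.psiMinus := by
  induction G generalizing i with
  | int n =>
    obtain rfl : i = 0 := hG
    obtain ⟨z, hz, rfl⟩ : ∃ z, IsLeaf 0 z ∧ n = z.toInt := by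
      rcases valuedIn_int.1 hv with rfl | rfl
      · exact ⟨zero, ⟨rfl, .inl rfl⟩, rfl⟩
      · exact ⟨one, ⟨rfl, .inr rfl⟩, rfl⟩
    have hr : Represents 0 z (PGame.ofInt z.toInt) := by
      rw [← val_of_isLeaf hz]
      exact ⟨le_rfl, le_rfl⟩
    have hc := fun s => hasValue_canon s 0 z
    simp only [canon_of_isLeaf hz] at hc
    exact ⟨z, z, z, le_rfl, hc 0, hc 1, hr, hr, hr⟩
  | node l r L R ihL ihR =>
    rw [valuedIn_node] at hv
    choose pL xL yL hleL h0L h1L hpL hxL hyL using fun k => ihL k (hG.1 k) (hv.1 k)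
    choose pR xR yR hleR h0R h1R hpR hxR hyR using fun k => ihR k (hG.2 k) (hv.2 k)
    -- The best option may differ for `ψ`, `ψ⁺` and `ψ⁻`, so each has its own maximizer and
    -- minimizer.
    obtain ⟨ap, hap⟩ := Finite.exists_max fun k => (pL k).tier
    obtain ⟨ax, hax⟩ := Finite.exists_max fun k => (xL k).tier
    obtain ⟨ay, hay⟩ := Finite.exists_max fun k => (yL k).tier
    obtain ⟨bp, hbp⟩ := Finite.exists_min fun k => (pR k).bar
    obtain ⟨bx, hbx⟩ := Finite.exists_min fun k => (xR k).bar
    obtain ⟨b_y, hby⟩ := Finite.exists_min fun k => (yR k).bar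
    refine ⟨_, _, _, step_mono i ((tier_mono (hleL ay)).trans (hax ay))
        ((hby bx).trans (bar_mono (hleR bx))),
      hasValue_of_options hG ?_ ⟨L ax, xL ax, ⟨ax, rfl⟩, h0L ax, rfl⟩ ?_
        ⟨R bx, xR bx, ⟨bx, rfl⟩, h0R bx, rfl⟩,
      hasValue_of_options hG ?_ ⟨L ay, yL ay, ⟨ay, rfl⟩, h1L ay, rfl⟩ ?_
        ⟨R b_y, yR b_y, ⟨b_y, rfl⟩, h1R b_y, rfl⟩,
      represents_mk hpL hpR hap hbp, (represents_braces hxL hxR hax hbx).1,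
      (represents_braces hyL hyR hay hby).2⟩
    · rintro _ ⟨k, rfl⟩
      exact ⟨xL k, h0L k, hax k⟩
    · rintro _ ⟨k, rfl⟩
      exact ⟨xR k, h0R k, hbx k⟩
    · rintro _ ⟨k, rfl⟩
      exact ⟨yL k, h1L k, hay k⟩
    · rintro _ ⟨k, rfl⟩
      exact ⟨yR k, h1R k, hby k⟩

end ScoringGame

/-! ### The operations `∨` and `∧` -/

namespace BoolValue

/-- The greatest value below the sum. -/
def cup : BoolValue → BoolValue → BoolValue
  | zero, y => y
  | x, zero => x
  | quarter, quarter => half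
  | quarter, threeEighths | threeEighths, quarter | quarter, halfStar | halfStar, quarter =>
    fiveEighths
  | quarter, half | half, quarter | quarter, fiveEighths | fiveEighths, quarter
  | threeEighths, threeEighths | threeEighths, half | half, threeEighths
  | threeEighths, halfStar | halfStar, threeEighths | half, halfStar | halfStar, half =>
    threeQuarters
  | _, _ => one

/-- The least value above the sum minus one. -/
def cap (x y : BoolValue) : BoolValue := (x.dual.cup y.dual).dual

theorem cup_toPGame_le : ∀ x y : BoolValue, (cup x y).toPGame ≤ x.toPGame + y.toPGame := by
  decide +kernel

theorem le_cup : ∀ x y z : BoolValue, z.toPGame ≤ x.toPGame + y.toPGame → z ≤ cup x y := by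
  decide +kernel

theorem le_cap_toPGame : ∀ x y : BoolValue,
    x.toPGame + y.toPGame - 1 ≤ (cap x y).toPGame := by
  decide +kernel

theorem cap_le : ∀ x y z : BoolValue, x.toPGame + y.toPGame - 1 ≤ z.toPGame → cap x y ≤ z := by
  decide +kernel

theorem toInt_cup : ∀ x y : BoolValue, IsLeaf 0 x → IsLeaf 0 y →
    IsLeaf 0 (cup x y) ∧ max x.toInt y.toInt = (cup x y).toInt := by
  decide +kernel

theorem toInt_cap : ∀ x y : BoolValue, IsLeaf 0 x → IsLeaf 0 y →
    IsLeaf 0 (cap x y) ∧ min x.toInt y.toInt = (cap x y).toInt := by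
  decide +kernel

/-- The values of the Left options of a combination of two canonical games. -/
def combinedLefts (g : BoolValue → BoolValue → BoolValue) (i j : ZMod 2) (x y : BoolValue) :
    List BoolValue :=
  (x.lefts i).map (g · y) ++ (y.lefts j).map (g x ·)

/-- The values of the Right options of a combination of two canonical games. -/
def combinedRights (g : BoolValue → BoolValue → BoolValue) (i j : ZMod 2) (x y : BoolValue) :
    List BoolValue :=
  (x.rights i).map (g · y) ++ (y.rights j).map (g x ·)

/-- `g` describes the effect of an operation on the values of games. -/
def IsCombination (g : BoolValue → BoolValue → BoolValue) : Prop :=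
  ∀ (s i j : ZMod 2) (x y : BoolValue), ¬ (IsLeaf i x ∧ IsLeaf j y) →
    ∃ a ∈ combinedLefts g i j x y, (∀ c ∈ combinedLefts g i j x y, c.tier ≤ a.tier) ∧
      ∃ b ∈ combinedRights g i j x y, (∀ c ∈ combinedRights g i j x y, b.bar ≤ c.bar) ∧
        step s (i + j) a.tier b.bar = g x y

/-- As the result is the same for both `s`, combinations of canonical games never meet the ambiguous
case of `step`. This is why one table serves `u⁺` and `u⁻`. -/
theorem isCombination_cup : IsCombination cup := by
  unfold IsCombination
  decide +kernel

theorem isCombination_cap : IsCombination cap := by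
  unfold IsCombination
  decide +kernel

end BoolValue

namespace ScoringGame

open BoolValue

theorem hasValue_ext2_canon {f : ℤ → ℤ → ℤ} {g : BoolValue → BoolValue → BoolValue}
    (hg : IsCombination g)
    (hfg : ∀ x y, IsLeaf 0 x → IsLeaf 0 y → IsLeaf 0 (g x y) ∧ f x.toInt y.toInt = (g x y).toInt)
    (s i j : ZMod 2) (x y : BoolValue) :
    HasValue s (i + j) (ext2 f (canon i x) (canon j y)) (g x y) := by
  induction i, x using canon_induction generalizing j y with
  | h i x ihxL ihxR =>
  induction j, y using canon_induction with
  | h j y ihyL ihyR =>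
  by_cases hl : IsLeaf i x ∧ IsLeaf j y
  · obtain ⟨hx, hy⟩ := hl
    obtain rfl := hx.1
    obtain rfl := hy.1
    rw [canon_of_isLeaf hx, canon_of_isLeaf hy, ext2_int_int, (hfg x y hx hy).2,
      ← canon_of_isLeaf (hfg x y hx hy).1]
    exact hasValue_canon s 0 _
  · obtain ⟨a, ha, ha', b, hb, hb', e⟩ := hg s i j x y hl
    have e1 : ∀ {K z}, HasValue s (i + 1 + j) K z → HasValue s (i + j + 1) K z := fun h => by
      rwa [add_right_comm] at h
    have e2 : ∀ {K z}, HasValue s (i + (j + 1)) K z → HasValue s (i + j + 1) K z := fun h => by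
      rwa [← add_assoc] at h
    have hL : ∀ c ∈ combinedLefts g i j x y, ∃ K, IsLeft K (ext2 f (canon i x) (canon j y)) ∧
        HasValue s (i + j + 1) K c := by
      intro c hc
      rcases List.mem_append.1 hc with hc | hc <;> obtain ⟨z, hz, rfl⟩ := List.mem_map.1 hc
      · exact ⟨_, isLeft_ext2.2 (.inl ⟨_, isLeft_canon.2 ⟨z, hz, rfl⟩, rfl⟩), e1 (ihxL z hz j y)⟩
      · exact ⟨_, isLeft_ext2.2 (.inr ⟨_, isLeft_canon.2 ⟨z, hz, rfl⟩, rfl⟩), e2 (ihyL z hz)⟩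
    have hR : ∀ c ∈ combinedRights g i j x y, ∃ K, IsRight K (ext2 f (canon i x) (canon j y)) ∧
        HasValue s (i + j + 1) K c := by
      intro c hc
      rcases List.mem_append.1 hc with hc | hc <;> obtain ⟨z, hz, rfl⟩ := List.mem_map.1 hc
      · exact ⟨_, isRight_ext2.2 (.inl ⟨_, isRight_canon.2 ⟨z, hz, rfl⟩, rfl⟩),
          e1 (ihxR z hz j y)⟩
      · exact ⟨_, isRight_ext2.2 (.inr ⟨_, isRight_canon.2 ⟨z, hz, rfl⟩, rfl⟩), e2 (ihyR z hz)⟩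
    rw [← e]
    obtain ⟨A, hA, hAa⟩ := hL a ha
    obtain ⟨B, hB, hBb⟩ := hR b hb
    refine hasValue_of_options ((tempered_canon i x).ext2 f (tempered_canon j y)) (fun K hK => ?_)
      ⟨A, a, hA, hAa, rfl⟩ (fun K hK => ?_) ⟨B, b, hB, hBb, rfl⟩
    · rcases isLeft_ext2.1 hK with ⟨_, hz, rfl⟩ | ⟨_, hz, rfl⟩ <;>
        obtain ⟨z, hm, rfl⟩ := isLeft_canon.1 hz
      · exact ⟨g z y, e1 (ihxL z hm j y),
          ha' _ (List.mem_append_left _ (List.mem_map.2 ⟨z, hm, rfl⟩))⟩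
      · exact ⟨g x z, e2 (ihyL z hm),
          ha' _ (List.mem_append_right _ (List.mem_map.2 ⟨z, hm, rfl⟩))⟩
    · rcases isRight_ext2.1 hK with ⟨_, hz, rfl⟩ | ⟨_, hz, rfl⟩ <;>
        obtain ⟨z, hm, rfl⟩ := isRight_canon.1 hz
      · exact ⟨g z y, e1 (ihxR z hm j y),
          hb' _ (List.mem_append_left _ (List.mem_map.2 ⟨z, hm, rfl⟩))⟩
      · exact ⟨g x z, e2 (ihyR z hm),
          hb' _ (List.mem_append_right _ (List.mem_map.2 ⟨z, hm, rfl⟩))⟩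

/-- Monotone extensions respect `Comp`, so both games may be replaced by their canonical games. -/
theorem HasValue.ext2 {f : ℤ → ℤ → ℤ} (hf : ∀ n, Monotone fun m => f m n)
    (hf' : ∀ m, Monotone fun n => f m n) {g : BoolValue → BoolValue → BoolValue}
    (hg : IsCombination g)
    (hfg : ∀ x y, IsLeaf 0 x → IsLeaf 0 y → IsLeaf 0 (g x y) ∧ f x.toInt y.toInt = (g x y).toInt)
    {s i j : ZMod 2} {G H : ScoringGame} {x y : BoolValue} (hG : HasValue s i G x)
    (hH : HasValue s j H y) : HasValue s (i + j) (ext2 f G H) (g x y) := by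
  have hc := hasValue_ext2_canon hg hfg s i j x y
  have hGH := hG.tempered.ext2 f hH.tempered
  exact ⟨hGH,
    .trans hGH hc.tempered (tempered_canon _ _)
      (.ext2_mono hf hf' hG.tempered (tempered_canon i x) hH.tempered (tempered_canon j y)
        hG.le hH.le) hc.le,
    .trans (tempered_canon _ _) hc.tempered hGH hc.ge
      (.ext2_mono hf hf' (tempered_canon i x) hG.tempered (tempered_canon j y) hH.tempered
        hG.ge hH.ge)⟩

theorem HasValue.max {s i j : ZMod 2} {G H : ScoringGame} {x y : BoolValue}
    (hG : HasValue s i G x) (hH : HasValue s j H y) :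
    HasValue s (i + j) (ScoringGame.ext2 max G H) (cup x y) :=
  hG.ext2 (f := Max.max) (fun _ _ _ h => max_le_max_right _ h)
    (fun _ _ _ h => max_le_max_left _ h) isCombination_cup toInt_cup hH

theorem HasValue.min {s i j : ZMod 2} {G H : ScoringGame} {x y : BoolValue}
    (hG : HasValue s i G x) (hH : HasValue s j H y) :
    HasValue s (i + j) (ScoringGame.ext2 min G H) (cap x y) :=
  hG.ext2 (f := Min.min) (fun _ _ _ h => min_le_min_right _ h)
    (fun _ _ _ h => min_le_min_left _ h) isCombination_cap toInt_cap hH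

/-! ### Realization of all pairs of values -/

/-- There is a Boolean-valued game of parity `i` with the given pair of values. -/
def Attained (i : ZMod 2) (p : BoolValue × BoolValue) : Prop :=
  ∃ G : ScoringGame, G.ValuedIn {0, 1} ∧ HasValue 0 i G p.1 ∧ HasValue 1 i G p.2

/-- The pair of values of the game with a single Left option and a single Right option. -/
def stepPair (i : ZMod 2) (p q : BoolValue × BoolValue) : BoolValue × BoolValue :=
  (step 0 i p.1.tier q.1.bar, step 1 i p.2.tier q.2.bar)

theorem attained_stepPair {i : ZMod 2} {p q : BoolValue × BoolValue} (hp : Attained (i + 1) p)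
    (hq : Attained (i + 1) q) : Attained i (stepPair i p q) := by
  obtain ⟨G, hG, hG0, hG1⟩ := hp
  obtain ⟨H, hH, hH0, hH1⟩ := hq
  have ht : (node 0 0 (fun _ => G) (fun _ => H)).Tempered i :=
    ⟨fun _ => hG0.tempered, fun _ => hH0.tempered⟩
  refine ⟨node 0 0 (fun _ => G) (fun _ => H), valuedIn_node.2 ⟨fun _ => hG, fun _ => hH⟩, ?_, ?_⟩
  · exact hasValue_of_options ht (fun K ⟨_, hK⟩ => ⟨p.1, hK ▸ hG0, le_rfl⟩)
      ⟨G, p.1, ⟨0, rfl⟩, hG0, rfl⟩ (fun K ⟨_, hK⟩ => ⟨q.1, hK ▸ hH0, le_rfl⟩)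
      ⟨H, q.1, ⟨0, rfl⟩, hH0, rfl⟩
  · exact hasValue_of_options ht (fun K ⟨_, hK⟩ => ⟨p.2, hK ▸ hG1, le_rfl⟩)
      ⟨G, p.2, ⟨0, rfl⟩, hG1, rfl⟩ (fun K ⟨_, hK⟩ => ⟨q.2, hK ▸ hH1, le_rfl⟩)
      ⟨H, q.2, ⟨0, rfl⟩, hH1, rfl⟩

theorem attained_diagonal (i : ZMod 2) (x : BoolValue) : Attained i (x, x) :=
  ⟨canon i x, valuedIn_canon i x, hasValue_canon 0 i x, hasValue_canon 1 i x⟩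

/-- The pairs with equal entries, followed by the pairs in a list. -/
def withDiagonal (l : List (BoolValue × BoolValue)) : List (BoolValue × BoolValue) :=
  [(zero, zero), (quarter, quarter), (threeEighths, threeEighths), (half, half),
    (halfStar, halfStar), (fiveEighths, fiveEighths), (threeQuarters, threeQuarters),
    (one, one)] ++ l

theorem attained_withDiagonal {i : ZMod 2} {l : List (BoolValue × BoolValue)}
    (h : ∀ p ∈ l, Attained i p) : ∀ p ∈ withDiagonal l, Attained i p := by
  intro p hp
  rcases List.mem_append.1 hp with hp | hp
  · simp only [List.mem_cons, List.not_mem_nil, or_false] at hp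
    rcases hp with rfl | rfl | rfl | rfl | rfl | rfl | rfl | rfl <;> exact attained_diagonal i _
  · exact h p hp

theorem attained_of_lists {i : ZMod 2} {l l' : List (BoolValue × BoolValue)}
    (h : ∀ p ∈ l, Attained (i + 1) p)
    (hl : ∀ p ∈ l', ∃ q ∈ withDiagonal l, ∃ r ∈ withDiagonal l, stepPair i q r = p) :
    ∀ p ∈ l', Attained i p := by
  intro p hp
  obtain ⟨q, hq, r, hr, rfl⟩ := hl p hp
  exact attained_stepPair (attained_withDiagonal h q hq) (attained_withDiagonal h r hr)

/-- Pairs which realize all combinations of tiers and of bars. -/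
def basicPairs : List (BoolValue × BoolValue) :=
  [(quarter, zero), (half, zero), (half, quarter), (threeQuarters, halfStar),
    (threeQuarters, fiveEighths), (one, zero), (one, quarter), (one, half), (one, threeQuarters)]

theorem attained (i : ZMod 2) (x y : BoolValue) (h : y ≤ x) : Attained i (x, y) := by
  -- The two entries first separate in even parity, at the zugzwang `{{1 | 0} | {1 | 0}}`. Further
  -- pairs come from single-option games of alternating parity until `basicPairs` is reached.
  have h0 : ∀ p ∈ [(one, zero)], Attained 0 p :=
    attained_of_lists (l := []) (by simp) (by decide +kernel)
  have h1 : ∀ p ∈ [(half, zero), (half, quarter), (halfStar, zero), (fiveEighths, half),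
      (threeQuarters, half), (one, zero), (one, half), (one, halfStar)], Attained 1 p :=
    attained_of_lists h0 (by decide +kernel)
  have h2 : ∀ p ∈ basicPairs, Attained 0 p := attained_of_lists h1 (by decide +kernel)
  -- From `basicPairs` and the diagonal, one more step gives every admissible pair in the opposite
  -- parity.
  have key : ∀ (i : ZMod 2) (x y : BoolValue), y ≤ x →
      ∃ q ∈ withDiagonal basicPairs, ∃ r ∈ withDiagonal basicPairs, stepPair i q r = (x, y) := by
    decide +kernel
  have h3 : ∀ x y, y ≤ x → Attained 1 (x, y) := fun x y hxy =>
    attained_of_lists (l' := [(x, y)]) h2 (by simpa using key 1 x y hxy) _ (by simp)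
  have h4 : ∀ p ∈ basicPairs, Attained 1 p := fun p hp =>
    h3 p.1 p.2 ((by decide : ∀ p ∈ basicPairs, p.2 ≤ p.1) p hp)
  rcases i.eq_zero_or_eq_one with rfl | rfl
  · exact attained_of_lists (l' := [(x, y)]) h4 (by simpa using key 0 x y h) _ (by simp)
  · exact h3 x y h

theorem outcome_mem_of_valuedIn {G : ScoringGame} (h : G.ValuedIn {0, 1}) :
    (0 ≤ G.leftOutcome ∧ G.leftOutcome ≤ 1) ∧ 0 ≤ G.rightOutcome ∧ G.rightOutcome ≤ 1 := by
  induction G with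
  | int n =>
    rcases valuedIn_int.1 h with rfl | rfl <;> decide
  | node l r L R ihL ihR =>
    rw [valuedIn_node] at h
    obtain ⟨_, ⟨k, rfl⟩, e⟩ := exists_isLeft (G := node l r L R) (by simp)
    obtain ⟨_, ⟨k', rfl⟩, e'⟩ := exists_isRight (G := node l r L R) (by simp)
    rw [e, e']
    exact ⟨(ihL k (h.1 k)).2, (ihR k' (h.2 k')).1⟩

/-! ### Parity as an invariant, and equivalence from comparison -/

/-- A game in which it is bad to move first. -/
def zugzwang : ScoringGame := node 0 0 (fun _ => int (-2)) (fun _ => int 2)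

/-- Nobody wants to move in `{-2 | 2}`, and the parity of `G` decides who has to. Scores in `[0, 1]`
shift by 2 up or down, so the two results cannot overlap. -/
theorem outcome_add_zugzwang {G : ScoringGame} {i : ZMod 2} (hG : G.Tempered i)
    (hv : G.ValuedIn {0, 1}) :
    (i = 0 → 2 ≤ (G + zugzwang).rightOutcome ∧ (G + zugzwang).leftOutcome ≤ -1) ∧
      (i = 1 → 2 ≤ (G + zugzwang).leftOutcome ∧ (G + zugzwang).rightOutcome ≤ -1) := by
  induction G using option_induction generalizing i with
  | h G ihL ihR =>
  have hn : ∀ c, G + zugzwang ≠ int c := fun c hc => by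
    obtain ⟨m, n, -, h, -⟩ := ext2_eq_int_iff.1 hc
    simp [zugzwang] at h
  have hvL : ∀ K, IsLeft K G → K.ValuedIn {0, 1} := fun K hK => by
    cases G with
    | int n => exact hK.elim
    | node l r L R => obtain ⟨k, rfl⟩ := hK; exact (valuedIn_node.1 hv).1 k
  have hvR : ∀ K, IsRight K G → K.ValuedIn {0, 1} := fun K hK => by
    cases G with
    | int n => exact hK.elim
    | node l r L R => obtain ⟨k, rfl⟩ := hK; exact (valuedIn_node.1 hv).2 k
  have hm : ∀ n : ℤ, Monotone fun m => m + n := fun n _ _ h => add_le_add_left h n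
  have hb := outcome_mem_of_valuedIn hv
  constructor
  · rintro rfl
    rw [le_rightOutcome_iff hn, leftOutcome_le_iff hn]
    constructor
    · intro K hK
      rcases isRight_ext2.1 hK with ⟨A, hA, rfl⟩ | ⟨_, ⟨k, rfl⟩, rfl⟩
      · exact ((ihR A hA (hG.isRight hA) (hvR A hA)).2 rfl).1
      · rw [(outcome_ext2_int 2 (hm 2) G).1]
        linarith
    · intro K hK
      rcases isLeft_ext2.1 hK with ⟨A, hA, rfl⟩ | ⟨_, ⟨k, rfl⟩, rfl⟩
      · exact ((ihL A hA (hG.isLeft hA) (hvL A hA)).2 rfl).2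
      · rw [(outcome_ext2_int (-2) (hm (-2)) G).2]
        linarith
  · rintro rfl
    have hG' : ∀ n, G ≠ int n := fun n hn => by
      subst hn
      exact one_ne_zero (show (1 : ZMod 2) = 0 from hG)
    obtain ⟨A, hA, -⟩ := exists_isLeft hG'
    obtain ⟨B, hB, -⟩ := exists_isRight hG'
    rw [le_leftOutcome_iff hn, rightOutcome_le_iff hn]
    -- An odd-tempered game is not an integer, so the first player can move in it and hand over the
    -- even case.
    exact ⟨⟨_, isLeft_ext2.2 (.inl ⟨A, hA, rfl⟩), ((ihL A hA (hG.isLeft hA) (hvL A hA)).1 rfl).1⟩,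
      ⟨_, isRight_ext2.2 (.inl ⟨B, hB, rfl⟩), ((ihR B hB (hG.isRight hB) (hvR B hB)).1 rfl).2⟩⟩

theorem Lesssim.parity_eq {G H : ScoringGame} {i j : ZMod 2} (h : Lesssim G H)
    (hG : G.Tempered i) (hH : H.Tempered j) (hGv : G.ValuedIn {0, 1})
    (hHv : H.ValuedIn {0, 1}) : i = j := by
  have hX := h zugzwang (.inr ⟨fun _ => rfl, fun _ => rfl⟩)
  have h1 := outcome_add_zugzwang hG hGv
  have h2 := outcome_add_zugzwang hH hHv
  by_contra hij
  rcases i.eq_zero_or_eq_one with rfl | rfl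
  · have := (h1.1 rfl).1
    have := (h2.2 (ZMod.eq_one_of_zero_ne hij)).2
    linarith
  · have := (h1.2 rfl).1
    have := (h2.1 (ZMod.add_one_eq_of_ne hij).symm).2
    linarith

theorem lesssim_of_comp {G H : ScoringGame} {i : ZMod 2} (hG : G.Tempered i) (hH : H.Tempered i)
    (h : ∀ s, Comp s true G H) : Lesssim G H := by
  intro X hX
  obtain ⟨j, hj⟩ : ∃ j, X.Tempered j := hX.elim (fun h => ⟨0, h⟩) (fun h => ⟨1, h⟩)
  have hc := fun s => (h s).ext2_left (fun n _ _ h => add_le_add_left h n) X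
  have hGX := hG.ext2 (fun a b => a + b) hj
  have hHX := hH.ext2 (fun a b => a + b) hj
  constructor
  -- The two outcomes of a sum of parity `i + j` belong to different last players, hence both values
  -- of `s` are needed.
  · exact (((hc (i + j + 1)).outcome _ hGX).1 rfl hHX).2 (ZMod.add_one_ne _).symm
  · exact (((hc (i + j)).outcome _ hGX).1 rfl hHX).1 rfl

theorem equivalent_iff {G H : ScoringGame} : Equivalent G H ↔ Lesssim G H ∧ Lesssim H G :=
  ⟨fun h => ⟨fun X hX => ⟨(h X hX).1.le, (h X hX).2.le⟩,
    fun X hX => ⟨(h X hX).1.ge, (h X hX).2.ge⟩⟩,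
    fun h X hX => ⟨le_antisymm (h.1 X hX).1 (h.2 X hX).1, le_antisymm (h.1 X hX).2 (h.2 X hX).2⟩⟩

theorem Tempered.parity_eq {G : ScoringGame} {i : ZMod 2} (h : G.Tempered i) : G.parity = i := by
  unfold parity
  split_ifs with h0
  · exact h0.unique h
  · exact (ZMod.eq_one_of_zero_ne fun e => h0 (e ▸ h)).symm

theorem WellTempered.tempered_parity {G : ScoringGame} (h : G.WellTempered) :
    G.Tempered G.parity := by
  rcases h with h | h <;> exact h.parity_eq.symm ▸ h

theorem exists_int_subgame (G : ScoringGame) : ∃ n, (int n).Subgame G := by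
  induction G with
  | int n => exact ⟨n, .refl _⟩
  | node l r L R ihL ihR =>
    obtain ⟨n, hn⟩ := ihL 0
    exact ⟨n, .left 0 hn⟩

theorem exists_canon_of_subgame {i : ZMod 2} {x : BoolValue} {H : ScoringGame}
    (h : H.Subgame (canon i x)) : ∃ j y, H = canon j y := by
  generalize hG : canon i x = G at h
  induction h generalizing i x with
  | refl => exact ⟨i, x, hG.symm⟩
  | left k h ih =>
    obtain ⟨y, -, hy⟩ := isLeft_canon.1 (show IsLeft _ (canon i x) by rw [hG]; exact ⟨k, rfl⟩)
    exact ih hy.symm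
  | right k h ih =>
    obtain ⟨y, -, hy⟩ := isRight_canon.1 (show IsRight _ (canon i x) by rw [hG]; exact ⟨k, rfl⟩)
    exact ih hy.symm

/-- Subgames of canonical games are canonical, and none of even parity is a zugzwang; an integer
subgame attains the supremum 0. -/
theorem evenGapZero_canon (i : ZMod 2) (x : BoolValue) : (canon i x).EvenGapZero := by
  obtain ⟨n, hn⟩ := exists_int_subgame (canon i x)
  have h0 : ∀ y : BoolValue, y.rightOutcome 0 - y.leftOutcome 0 ≤ 0 := by decide +kernel
  refine IsGreatest.isLUB ⟨⟨int n, hn, Tempered.parity_eq (i := 0) rfl, (sub_self n).symm⟩, ?_⟩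
  rintro _ ⟨H, hH, hp, rfl⟩
  obtain ⟨j, y, rfl⟩ := exists_canon_of_subgame hH
  obtain rfl : j = 0 := (tempered_canon j y).parity_eq.symm.trans hp
  rw [(outcome_canon 0 y).1, (outcome_canon 0 y).2]
  exact h0 y

end ScoringGame

/-! ### Passage from the names to the set `S` -/

namespace BoolValue

theorem val_eq_val_iff {G H : PGame} : G.val = H.val ↔ G ≤ H ∧ H ≤ G :=
  Quotient.eq.trans Iff.rfl

theorem Represents.val_eq_iff {i : ZMod 2} {x y : BoolValue} {G : PGame}
    (h : Represents i x G) : G.val = (PGame.parityOverheat i y.toPGame).val ↔ y = x := by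
  have hy := parityOverheat_equiv i y
  rw [val_eq_val_iff]
  constructor
  · rintro ⟨h1, h2⟩
    exact le_antisymm (val_le_val.1 (hy.2.trans (h2.trans h.1)))
      (val_le_val.1 (h.2.trans (h1.trans hy.1)))
  · rintro rfl
    exact ⟨h.1.trans hy.2, hy.1.trans h.2⟩

theorem toPGame_injective : Function.Injective toPGame := fun _ _ h =>
  le_antisymm (toPGame_le_toPGame.1 h.le) (toPGame_le_toPGame.1 h.ge)

theorem toPGame_mem (x : BoolValue) : x.toPGame ∈ PGame.boolS := by
  cases x <;> simp [PGame.boolS, toPGame]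

theorem exists_toPGame_eq {p : PGame} (h : p ∈ PGame.boolS) : ∃ x : BoolValue, x.toPGame = p := by
  rcases h with rfl | rfl | rfl | rfl | rfl | rfl | rfl | rfl
  exacts [⟨zero, rfl⟩, ⟨quarter, rfl⟩, ⟨threeEighths, rfl⟩, ⟨half, rfl⟩, ⟨halfStar, rfl⟩,
    ⟨fiveEighths, rfl⟩, ⟨threeQuarters, rfl⟩, ⟨one, rfl⟩]

/-- The names correspond to the elements of `boolS`. -/
noncomputable def equivBoolS : BoolValue ≃ PGame.boolS :=
  Equiv.ofBijective (fun x => ⟨x.toPGame, x.toPGame_mem⟩)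
    ⟨fun _ _ h => toPGame_injective (congrArg Subtype.val h), fun ⟨_, hp⟩ =>
      (exists_toPGame_eq hp).imp fun _ h => Subtype.ext h⟩

theorem coe_equivBoolS (x : BoolValue) : (equivBoolS x : PGame) = x.toPGame := rfl

theorem equivBoolS_le {x y : BoolValue} : equivBoolS x ≤ equivBoolS y ↔ x ≤ y :=
  toPGame_le_toPGame

theorem card_pairs :
    Nat.card {p : PGame.boolS × PGame.boolS × ZMod 2 // p.2.1 ≤ p.1} = 70 := by
  have e : {p : BoolValue × BoolValue × ZMod 2 // p.2.1 ≤ p.1} ≃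
      {p : PGame.boolS × PGame.boolS × ZMod 2 // p.2.1 ≤ p.1} :=
    (equivBoolS.prodCongr (equivBoolS.prodCongr (Equiv.refl _))).subtypeEquiv fun _ =>
      equivBoolS_le.symm
  rw [← Nat.card_congr e, Nat.card_eq_fintype_card]
  decide +kernel

end BoolValue

/-! ### Classification of Boolean-valued games -/

namespace BoolGame

open BoolValue

theorem exists_values (G : BoolGame) : ∃ v : ZMod 2 → BoolValue, v 1 ≤ v 0 ∧
    (∀ s, G.1.HasValue s G.1.parity (v s)) ∧ Represents G.1.parity (v 0) G.1.psiPlus ∧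
      Represents G.1.parity (v 1) G.1.psiMinus := by
  obtain ⟨p, x, y, h, h0, h1, -, hx, hy⟩ :=
    ScoringGame.exists_values G.2.1.tempered_parity G.2.2
  refine ⟨fun s => if s = 0 then x else y, h, fun s => ?_, hx, hy⟩
  rcases s.eq_zero_or_eq_one with rfl | rfl
  · exact h0
  · exact h1

/-- The values `u⁺(G)`, for `s = 0`, and `u⁻(G)`, for `s = 1`. -/
noncomputable def value (s : ZMod 2) (G : BoolGame) : BoolValue := G.exists_values.choose s

theorem value_one_le_value_zero (G : BoolGame) : G.value 1 ≤ G.value 0 :=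
  G.exists_values.choose_spec.1

theorem hasValue (s : ZMod 2) (G : BoolGame) : G.1.HasValue s G.1.parity (G.value s) :=
  G.exists_values.choose_spec.2.1 s

theorem represents_psiPlus (G : BoolGame) : Represents G.1.parity (G.value 0) G.1.psiPlus :=
  G.exists_values.choose_spec.2.2.1

theorem represents_psiMinus (G : BoolGame) : Represents G.1.parity (G.value 1) G.1.psiMinus :=
  G.exists_values.choose_spec.2.2.2

theorem value_eq {s i : ZMod 2} {G : BoolGame} {x : BoolValue} (h : G.1.HasValue s i x) :
    G.value s = x := by
  have hG := G.hasValue s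
  rw [h.tempered.parity_eq] at hG
  exact hG.unique h

theorem lesssim_iff {G H : BoolGame} : G.1.Lesssim H.1 ↔
    G.value 0 ≤ H.value 0 ∧ G.value 1 ≤ H.value 1 ∧ G.1.parity = H.1.parity := by
  constructor
  · intro h
    have hp := h.parity_eq G.2.1.tempered_parity H.2.1.tempered_parity G.2.2 H.2.2
    exact ⟨(G.hasValue 0).le_of_lesssim (hp ▸ H.hasValue 0) h,
      (G.hasValue 1).le_of_lesssim (hp ▸ H.hasValue 1) h, hp⟩
  · rintro ⟨h0, h1, hp⟩
    refine ScoringGame.lesssim_of_comp G.2.1.tempered_parity (hp ▸ H.2.1.tempered_parity)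
      fun s => (G.hasValue s).comp (hp ▸ H.hasValue s) ?_
    rcases s.eq_zero_or_eq_one with rfl | rfl
    exacts [h0, h1]

/-- The canonical game as a Boolean-valued game. -/
def canon (i : ZMod 2) (x : BoolValue) : BoolGame :=
  ⟨ScoringGame.canon i x, by
    have h := ScoringGame.tempered_canon i x
    rcases i.eq_zero_or_eq_one with rfl | rfl
    exacts [.inl h, .inr h], ScoringGame.valuedIn_canon i x⟩

theorem parity_canon (i : ZMod 2) (x : BoolValue) : (canon i x).1.parity = i :=
  (ScoringGame.tempered_canon i x).parity_eq

theorem value_canon (s i : ZMod 2) (x : BoolValue) : (canon i x).value s = x :=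
  value_eq (ScoringGame.hasValue_canon s i x)

/-- The predicate `P` treats all games and the games of even gap zero at once: canonical games
already realize every value. -/
theorem values_eq (i : ZMod 2) {ψ : ScoringGame → PGame} {P : BoolGame → Prop}
    (h : ∀ G : BoolGame, ∃ x, Represents G.1.parity x (ψ G.1))
    (hc : ∀ x, P (canon i x) ∧ Represents i x (ψ (canon i x).1)) :
    {v : Pg | ∃ G : BoolGame, G.1.parity = i ∧ P G ∧ v = (ψ G.1).val} =
      {v : Pg | ∃ x ∈ PGame.boolS, v = (PGame.parityOverheat i x).val} := by
  ext v
  constructor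
  · rintro ⟨G, rfl, -, rfl⟩
    obtain ⟨x, hx⟩ := h G
    exact ⟨x.toPGame, x.toPGame_mem, hx.val_eq_iff.2 rfl⟩
  · rintro ⟨p, hp, rfl⟩
    obtain ⟨x, rfl⟩ := exists_toPGame_eq hp
    exact ⟨canon i x, parity_canon i x, (hc x).1, ((hc x).2.val_eq_iff.2 rfl).symm⟩

theorem disjoint_values :
    Disjoint {v : Pg | ∃ x ∈ PGame.boolS, v = (PGame.overheat x).val}
      {v : Pg | ∃ x ∈ PGame.boolS, v = (PGame.star + PGame.overheat x).val} := by
  -- Equality of values across parities would violate both alternatives.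
  have htb : ∀ x y : BoolValue, x.tier ≤ y.bar ∨ y.tier ≤ x.bar := by decide +kernel
  rw [Set.disjoint_left]
  rintro _ ⟨p, hp, rfl⟩ ⟨q, hq, h⟩
  obtain ⟨x, rfl⟩ := exists_toPGame_eq hp
  obtain ⟨y, rfl⟩ := exists_toPGame_eq hq
  rw [val_eq_val_iff] at h
  have hx := parityOverheat_equiv 0 x
  have hy := parityOverheat_equiv 1 y
  have h1 : val 0 x ≤ val (0 + 1) y := hx.2.trans (h.1.trans hy.1)
  have h2 : val (0 + 1) y ≤ val 0 x := hy.2.trans (h.2.trans hx.1)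
  rw [val_le_val_add_one] at h1
  rw [val_add_one_le_val] at h2
  exact (htb x y).elim h2 h1

/-- The bijection between the classes of Boolean-valued games and the pairs of values. -/
theorem exists_equiv :
    ∃ e : BoolGameClass ≃ {p : PGame.boolS × PGame.boolS × ZMod 2 // p.2.1 ≤ p.1},
      ∀ G : BoolGame, (e ⟦G⟧ : PGame.boolS × PGame.boolS × ZMod 2) =
        (equivBoolS (G.value 0), equivBoolS (G.value 1), G.1.parity) := by
  have hequiv : ∀ G H : BoolGame, ScoringGame.Equivalent G.1 H.1 ↔
      G.value 0 = H.value 0 ∧ G.value 1 = H.value 1 ∧ G.1.parity = H.1.parity := fun G H => by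
    rw [ScoringGame.equivalent_iff, lesssim_iff, lesssim_iff]
    constructor
    · rintro ⟨⟨h0, h1, h2⟩, h0', h1', -⟩
      exact ⟨h0.antisymm h0', h1.antisymm h1', h2⟩
    · rintro ⟨h0, h1, h2⟩
      exact ⟨⟨h0.le, h1.le, h2⟩, h0.ge, h1.ge, h2.symm⟩
  let F : BoolGameClass → {p : PGame.boolS × PGame.boolS × ZMod 2 // p.2.1 ≤ p.1} :=
    Quotient.lift (fun G => ⟨(equivBoolS (G.value 0), equivBoolS (G.value 1), G.1.parity),
      equivBoolS_le.2 G.value_one_le_value_zero⟩) fun G H h => by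
        obtain ⟨h0, h1, h2⟩ := (hequiv G H).1 h
        simp only [h0, h1, h2]
  refine ⟨Equiv.ofBijective F ⟨?_, ?_⟩, fun G => rfl⟩
  · rintro ⟨G⟩ ⟨H⟩ h
    have h' := congrArg Subtype.val h
    simp only [F, Prod.mk.injEq, EmbeddingLike.apply_eq_iff_eq] at h'
    exact Quotient.sound ((hequiv G H).2 h')
  · rintro ⟨⟨p, q, i⟩, hpq⟩
    obtain ⟨x, rfl⟩ := equivBoolS.surjective p
    obtain ⟨y, rfl⟩ := equivBoolS.surjective q
    obtain ⟨G, hv, h0, h1⟩ := ScoringGame.attained i x y (equivBoolS_le.1 hpq)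
    have hw : G.WellTempered := by
      have := h0.tempered
      rcases i.eq_zero_or_eq_one with rfl | rfl
      exacts [.inl this, .inr this]
    refine ⟨⟦⟨G, hw, hv⟩⟧, Subtype.ext ?_⟩
    have e0 := value_eq (G := ⟨G, hw, hv⟩) h0
    have e1 := value_eq (G := ⟨G, hw, hv⟩) h1
    simp only [F, Quotient.lift_mk, e0, e1, h0.tempered.parity_eq]

theorem value_or (s : ZMod 2) (G H : BoolGame) :
    (G.or H).value s = cup (G.value s) (H.value s) :=
  value_eq ((G.hasValue s).max (H.hasValue s))

theorem value_and (s : ZMod 2) (G H : BoolGame) :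
    (G.and H).value s = cap (G.value s) (H.value s) :=
  value_eq ((G.hasValue s).min (H.hasValue s))

end BoolGame

/-! ### The main theorem -/

open PGame in
theorem mainTheorem3 :
    -- the values of `ψ`, `ψ⁺` and `ψ⁻` on the even-tempered and on the odd-tempered Boolean games
    (∀ i : ZMod 2,
      {v : Pg | ∃ G : BoolGame, G.1.parity = i ∧ v = G.1.psi.val} =
          {v : Pg | ∃ x ∈ boolS, v = (parityOverheat i x).val} ∧
      {v : Pg | ∃ G : BoolGame, G.1.parity = i ∧ G.1.EvenGapZero ∧ v = G.1.psi.val} =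
          {v : Pg | ∃ x ∈ boolS, v = (parityOverheat i x).val} ∧
      {v : Pg | ∃ G : BoolGame, G.1.parity = i ∧ v = G.1.psiPlus.val} =
          {v : Pg | ∃ x ∈ boolS, v = (parityOverheat i x).val} ∧
      {v : Pg | ∃ G : BoolGame, G.1.parity = i ∧ v = G.1.psiMinus.val} =
          {v : Pg | ∃ x ∈ boolS, v = (parityOverheat i x).val}) ∧
    Disjoint {v : Pg | ∃ x ∈ boolS, v = (overheat x).val}
      {v : Pg | ∃ x ∈ boolS, v = (star + overheat x).val} ∧
    -- the `u`-values
    ∃ uPlus uMinus : BoolGame → boolS,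
      -- `u^±(G)` is the unique element of `S` that represents `ψ^±(G)`
      (∀ (G : BoolGame) (x : boolS),
        G.1.psiPlus.val = (parityOverheat G.1.parity x).val ↔ x = uPlus G) ∧
      (∀ (G : BoolGame) (x : boolS),
        G.1.psiMinus.val = (parityOverheat G.1.parity x).val ↔ x = uMinus G) ∧
      -- the classification up to equivalence, with the order
      (∃ e : BoolGameClass ≃ {p : boolS × boolS × ZMod 2 // p.2.1 ≤ p.1},
        ∀ G : BoolGame, (e ⟦G⟧ : boolS × boolS × ZMod 2) = (uPlus G, uMinus G, G.1.parity)) ∧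
      (∀ G H : BoolGame, ScoringGame.Lesssim G.1 H.1 ↔
        uPlus G ≤ uPlus H ∧ uMinus G ≤ uMinus H ∧ G.1.parity = H.1.parity) ∧
      Nat.card BoolGameClass = 70 ∧
      -- the effect of `∨` and `∧`
      (∃ cup cap : boolS → boolS → boolS,
        (∀ x y : boolS, IsGreatest {z : boolS | (z : PGame) ≤ (x : PGame) + y} (cup x y)) ∧
        (∀ x y : boolS, IsLeast {w : boolS | (x : PGame) + y - 1 ≤ (w : PGame)} (cap x y)) ∧
        ∀ G H : BoolGame,
          uPlus (G.or H) = cup (uPlus G) (uPlus H) ∧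
          uMinus (G.or H) = cup (uMinus G) (uMinus H) ∧
          uPlus (G.and H) = cap (uPlus G) (uPlus H) ∧
          uMinus (G.and H) = cap (uMinus G) (uMinus H)) ∧
      -- the outcomes
      (∀ G : BoolGame, G.1.parity = 0 →
        (G.1.leftOutcome = 0 ↔ (uMinus G : PGame) = 0) ∧
        (G.1.rightOutcome = 1 ↔ (uPlus G : PGame) = 1)) ∧
      (∀ G : BoolGame, G.1.parity = 1 →
        (G.1.leftOutcome = 0 ↔ (uPlus G : PGame) ≤ half) ∧
        (G.1.rightOutcome = 1 ↔ half ≤ (uMinus G : PGame))) := by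
  have hpsi : ∀ G : BoolGame, ∃ x, BoolValue.Represents G.1.parity x G.1.psi := fun G => by
    obtain ⟨p, -, -, -, -, -, h, -⟩ := ScoringGame.exists_values G.2.1.tempered_parity G.2.2
    exact ⟨p, h⟩
  have hcanon : ∀ i x, BoolValue.Represents i x (BoolGame.canon i x).1.psi := fun i x =>
    ⟨le_rfl, le_rfl⟩
  refine ⟨fun i => ⟨?_, ?_, ?_, ?_⟩, BoolGame.disjoint_values,
    fun G => BoolValue.equivBoolS (G.value 0), fun G => BoolValue.equivBoolS (G.value 1),
    fun G x => ?_, fun G x => ?_, BoolGame.exists_equiv, fun G H => ?_, ?_,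
    ⟨fun x y => BoolValue.equivBoolS
      (BoolValue.cup (BoolValue.equivBoolS.symm x) (BoolValue.equivBoolS.symm y)),
     fun x y => BoolValue.equivBoolS
      (BoolValue.cap (BoolValue.equivBoolS.symm x) (BoolValue.equivBoolS.symm y)),
     fun x y => ?_, fun x y => ?_, fun G H => ?_⟩, fun G hG => ?_, fun G hG => ?_⟩
  · simpa only [true_and] using BoolGame.values_eq i (P := fun _ => True) hpsi
      fun x => ⟨trivial, hcanon i x⟩
  · exact BoolGame.values_eq i hpsi fun x => ⟨ScoringGame.evenGapZero_canon i x, hcanon i x⟩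
  · simpa only [true_and] using BoolGame.values_eq i (P := fun _ => True)
      (fun G => ⟨_, G.represents_psiPlus⟩) fun x => ⟨trivial, by
        have h := (BoolGame.canon i x).represents_psiPlus
        rwa [BoolGame.value_canon, BoolGame.parity_canon] at h⟩
  · simpa only [true_and] using BoolGame.values_eq i (P := fun _ => True)
      (fun G => ⟨_, G.represents_psiMinus⟩) fun x => ⟨trivial, by
        have h := (BoolGame.canon i x).represents_psiMinus
        rwa [BoolGame.value_canon, BoolGame.parity_canon] at h⟩
  · obtain ⟨x, rfl⟩ := BoolValue.equivBoolS.surjective x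
    rw [BoolValue.coe_equivBoolS, G.represents_psiPlus.val_eq_iff, EmbeddingLike.apply_eq_iff_eq]
  · obtain ⟨x, rfl⟩ := BoolValue.equivBoolS.surjective x
    rw [BoolValue.coe_equivBoolS, G.represents_psiMinus.val_eq_iff, EmbeddingLike.apply_eq_iff_eq]
  · rw [BoolGame.lesssim_iff, BoolValue.equivBoolS_le, BoolValue.equivBoolS_le]
  · obtain ⟨e, -⟩ := BoolGame.exists_equiv
    rw [Nat.card_congr e, BoolValue.card_pairs]
  · obtain ⟨x, rfl⟩ := BoolValue.equivBoolS.surjective x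
    obtain ⟨y, rfl⟩ := BoolValue.equivBoolS.surjective y
    simp only [Equiv.symm_apply_apply]
    refine ⟨BoolValue.cup_toPGame_le x y, fun z hz => ?_⟩
    obtain ⟨z, rfl⟩ := BoolValue.equivBoolS.surjective z
    exact BoolValue.equivBoolS_le.2 (BoolValue.le_cup x y z hz)
  · obtain ⟨x, rfl⟩ := BoolValue.equivBoolS.surjective x
    obtain ⟨y, rfl⟩ := BoolValue.equivBoolS.surjective y
    simp only [Equiv.symm_apply_apply]
    refine ⟨BoolValue.le_cap_toPGame x y, fun z hz => ?_⟩
    obtain ⟨z, rfl⟩ := BoolValue.equivBoolS.surjective z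
    exact BoolValue.equivBoolS_le.2 (BoolValue.cap_le x y z hz)
  · simp only [Equiv.symm_apply_apply, BoolGame.value_or, BoolGame.value_and, and_self]
  · have h0 := G.hasValue 0
    have h1 := G.hasValue 1
    rw [hG] at h0 h1
    -- In an even-tempered game Right moves last if Left starts, so the left outcome is read from
    -- `u⁻` and the right outcome from `u⁺`; in odd parity the roles are exchanged.
    rw [h0.rightOutcome_eq, ScoringGame.HasValue.leftOutcome_eq (s := 1) h1,
      BoolValue.coe_equivBoolS, BoolValue.coe_equivBoolS]
    have hz : BoolValue.toPGame .zero = 0 := rfl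
    have ho : BoolValue.toPGame .one = 1 := rfl
    rw [← hz, ← ho, BoolValue.toPGame_injective.eq_iff, BoolValue.toPGame_injective.eq_iff]
    exact ⟨(by decide : ∀ x : BoolValue, x.leftOutcome (1 + 1) = 0 ↔ x = .zero) _,
      (by decide : ∀ x : BoolValue, x.rightOutcome 0 = 1 ↔ x = .one) _⟩
  · have h0 := G.hasValue 0
    have h1 := G.hasValue 1
    rw [hG] at h0 h1
    rw [h1.rightOutcome_eq, ScoringGame.HasValue.leftOutcome_eq (s := 0) h0,
      BoolValue.coe_equivBoolS, BoolValue.coe_equivBoolS]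
    have hh : BoolValue.toPGame .half = half := rfl
    rw [← hh, BoolValue.toPGame_le_toPGame, BoolValue.toPGame_le_toPGame]
    exact ⟨(by decide : ∀ x : BoolValue, x.leftOutcome (0 + 1) = 0 ↔ x ≤ .half) _,
      (by decide : ∀ x : BoolValue, x.rightOutcome 1 = 1 ↔ .half ≤ x) _⟩
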